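/- \textbf{Setting.} Let $\tilde\Omega\subset\mathbb R^2$ be a bounded open set with Lipschitz boundary, let $D$ be an open set with Lipschitz boundary and $\overline D\subset\tilde\Omega$, and put $\Omega=\tilde\Omega\setminus\overline D$ and $\Gamma_5=\partial D$. Let $\partial\tilde\Omega=\Gamma_1\cup\Gamma_2\cup\Gamma_3\cup\Gamma_4$ with measurable parts that are pairwise disjoint up to sets of length zero, where $\Gamma_3=\Gamma_2+p$ is a translate of $\Gamma_2$. Put $\Gamma=\Gamma_1\cup\dots\cup\Gamma_5=\partial\Omega$, and let $\vec n$ be the unit normal on $\Gamma$ pointing out of $\Omega$. Boundary values are traces, boundary integrals are with respect to arc length, $\Delta$ is the weak Laplacian, and normal derivatives of functions in $H^1(\Omega)$ with Laplacian in $L^2(\Omega)$ are defined by Green's formula: $\int_\Gamma\frac{\partial w}{\partial\vec n}\varphi\,ds=\int_\Omega(\nabla w\cdot\nabla\varphi+\Delta w\,\varphi)\,dx$ for all $\varphi\in C^\infty(\overline\Omega)$. Write $(f,g)_{X}=\Re\int_{X}f\bar g$. Let $k>0$, $A>0$, $\theta\in\mathbb R$, $u_{inc}(x)=A\exp(ik\,x\cdot(\cos\theta,\sin\theta))$,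 and $\alpha=i\,\frac{1-K}{1+K}$ with a real reflection coefficient $K\ne-1$. Let $u_0\in L^2(\Gamma_1)$ be complex-valued, and let $u\in H^1(\Omega)$, with $\frac{\partial u}{\partial\vec n}\in L^2(\Gamma)$, be a solution of the state problem $$-\Delta u-k^2u=0\ \text{on }\Omega,\qquad \tfrac{\partial u}{\partial\vec n}+k\alpha u=0\ \text{on }\Gamma_1,\Gamma_5,\qquad u|_{\Gamma_2}=u|_{\Gamma_3},\qquad \tfrac{\partial(u-u_{inc})}{\partial\vec n}-ik(u-u_{inc})=0\ \text{on }\Gamma_4,$$ where $u|_{\Gamma_2}=u|_{\Gamma_3}$ means $u(x)=u(x+p)$ for almost every $x\in\Gamma_2$. For $v\in H^1(\Omega)$ and $v_1\in L^2(\Gamma_1\cup\Gamma_5)$, $v_2\in L^2(\Gamma_2\cup\Gamma_3)$, $v_3\in L^2(\Gamma_4)$ (for instance traces of $H^1(\Omega)$ functions) consider the Lagrangian, without variance and perimeter terms, $$\begin{aligned}\mathcal L(u,v,v_1,v_2,v_3)={}&\tfrac12(u-u_0,u-u_0)_{\Gamma_1}+(\nabla u,\nabla v)_{\Omega}-k^2(u,v)_{\Omega}-\big(\tfrac{\partial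 u}{\partial\vec n},v\big)_{\Gamma}-\big(\tfrac{\partial u}{\partial\vec n}+k\alpha u,v_1\big)_{\Gamma_1\cup\Gamma_5}\\&+(u,v_2)_{\Gamma_2}+(u,v_2)_{\Gamma_3}-\big(\tfrac{\partial(u-u_{inc})}{\partial\vec n}-ik(u-u_{inc}),v_3\big)_{\Gamma_4}.\end{aligned}$$ Call $v\in H^1(\Omega)$ an \emph{adjoint} at $u$ if, for some such $v_1,v_2,v_3$, one has $\frac{d}{d\epsilon}\mathcal L(u+\epsilon\tilde u,v,v_1,v_2,v_3)|_{\epsilon=0}=0$ for all $\tilde u\in C^\infty(\overline\Omega;\mathbb C)$. \textbf{Theorem (Adjoint).} A function $v\in H^1(\Omega)$ is an adjoint at $u$ if and only if $\Delta v\in L^2(\Omega)$, $v$ has a normal derivative in $L^2(\Gamma)$, and $$\begin{aligned}-\Delta v-k^2v&=0&&\text{on }\Omega,\\ \tfrac{\partial v}{\partial\vec n}&=-(u-u_0)+k\alpha v&&\text{on }\Gamma_1,\\ \tfrac{\partial v}{\partial\vec n}&=k\alpha v&&\text{on }\Gamma_5,\\ \tfrac{\partial v}{\partial\vec n}&=-ikv&&\text{on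 }\Gamma_4,\\ v&=0&&\text{on }\Gamma_2,\Gamma_3.\end{aligned}$$ -/

import Mathlib

open MeasureTheory Filter Topology
open scoped ContDiff ComplexConjugate ENNReal

noncomputable section

namespace Helmholtz

/-- The Euclidean plane. -/
abbrev Plane : Type := EuclideanSpace ℝ (Fin 2)

/-! ### Lipschitz domains, surface measure and outward normal -/

/-- Near each of its boundary points, `U` is, after a rigid motion, the set of points lying
strictly below the graph of a Lipschitz function. -/
def HasLipschitzBoundary (U : Set Plane) : Prop :=
  ∀ p ∈ frontier U, ∃ (R : Plane ≃ₗᵢ[ℝ] Plane) (g : ℝ → ℝ) (C : NNReal), LipschitzWith C g ∧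
    ∀ᶠ z in 𝓝 p, (z ∈ U ↔ (R (z - p)) 1 < g ((R (z - p)) 0))

/-- `ν` is the outward unit normal of `U` at `x`: to first order at `x`, the set `U` is the
half-plane `{y | ⟪y - x, ν⟫ < 0}`. There is at most one such `ν`, and on a Lipschitz boundary it
exists at almost every point. -/
def IsOutwardNormalAt (U : Set Plane) (x ν : Plane) : Prop :=
  ‖ν‖ = 1 ∧ ∀ ε : ℝ, 0 < ε → ∀ᶠ y in 𝓝 x,
    (inner ℝ (y - x) ν < -(ε * ‖y - x‖) → y ∈ U) ∧
    (ε * ‖y - x‖ < inner ℝ (y - x) ν → y ∉ U)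

open Classical in
/-- The outward unit normal field of `U` (zero at the points where there is no normal). -/
def outwardNormal (U : Set Plane) (x : Plane) : Plane :=
  if h : ∃ ν, IsOutwardNormalAt U x ν then h.choose else 0

/-- Arc length, the one-dimensional Hausdorff measure, on a subset `Γ` of a curve. -/
def arcLength (Γ : Set Plane) : Measure Plane :=
  (Measure.hausdorffMeasure 1 : Measure Plane).restrict Γ

/-- The geometric setting: `Ω̃` (`tank`), the obstacle `D` compactly contained in it, and the
decomposition of `∂Ω̃` into the coast `Γ₁`, the lateral sides `Γ₂`, `Γ₃` (which are translates of
each other, so that periodic conditions make sense) and the open sea `Γ₄`. The four parts may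
share end points. -/
structure Configuration where
  tank : Set Plane
  obstacle : Set Plane
  Γ₁ : Set Plane
  Γ₂ : Set Plane
  Γ₃ : Set Plane
  Γ₄ : Set Plane
  period : Plane
  isOpen_tank : IsOpen tank
  isBounded_tank : Bornology.IsBounded tank
  lipschitz_tank : HasLipschitzBoundary tank
  isOpen_obstacle : IsOpen obstacle
  lipschitz_obstacle : HasLipschitzBoundary obstacle
  closure_obstacle_subset : closure obstacle ⊆ tank
  union_eq : Γ₁ ∪ Γ₂ ∪ Γ₃ ∪ Γ₄ = frontier tank
  measurable₁ : MeasurableSet Γ₁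
  measurable₂ : MeasurableSet Γ₂
  measurable₃ : MeasurableSet Γ₃
  measurable₄ : MeasurableSet Γ₄
  disjoint₁₂ : AEDisjoint (Measure.hausdorffMeasure 1) Γ₁ Γ₂
  disjoint₁₃ : AEDisjoint (Measure.hausdorffMeasure 1) Γ₁ Γ₃
  disjoint₁₄ : AEDisjoint (Measure.hausdorffMeasure 1) Γ₁ Γ₄
  disjoint₂₃ : AEDisjoint (Measure.hausdorffMeasure 1) Γ₂ Γ₃
  disjoint₂₄ : AEDisjoint (Measure.hausdorffMeasure 1) Γ₂ Γ₄
  disjoint₃₄ : AEDisjoint (Measure.hausdorffMeasure 1) Γ₃ Γ₄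
  translate : Γ₃ = (fun x => x + period) '' Γ₂

/-- The water domain: `Ω̃` without the closed obstacle. -/
def Configuration.Ω (S : Configuration) : Set Plane := S.tank \ closure S.obstacle

/-- The boundary of the obstacle. -/
def Configuration.Γ₅ (S : Configuration) : Set Plane := frontier S.obstacle

/-- The whole boundary `Γ` of `Ω`. -/
def Configuration.Γ (S : Configuration) : Set Plane :=
  S.Γ₁ ∪ S.Γ₂ ∪ S.Γ₃ ∪ S.Γ₄ ∪ S.Γ₅

/-- The outward unit normal of `Ω`. -/
def Configuration.normal (S : Configuration) : Plane → Plane := outwardNormal S.Ω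

/-! ### Sobolev functions, traces, weak Laplacian, weak normal derivative -/

/-- Smooth complex functions with compact support in the plane. Their restrictions to the closure
of a bounded set are the functions that are smooth up to the boundary. -/
def IsTest (φ : Plane → ℂ) : Prop := ContDiff ℝ ∞ φ ∧ HasCompactSupport φ

/-- The classical partial derivative of `φ` in the direction of the `i`-th coordinate. -/
def pderiv (i : Fin 2) (φ : Plane → ℂ) (x : Plane) : ℂ :=
  fderiv ℝ φ x (EuclideanSpace.single i 1)

/-- `f ∈ H¹(U)`, with weak partial derivatives `G 0`, `G 1`. -/
def IsH1 (U : Set Plane) (f : Plane → ℂ) (G : Fin 2 → Plane → ℂ) : Prop :=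
  MemLp f 2 (volume.restrict U) ∧ (∀ i, MemLp (G i) 2 (volume.restrict U)) ∧
    ∀ φ, IsTest φ → tsupport φ ⊆ U → ∀ i,
      ∫ x in U, f x * pderiv i φ x = -∫ x in U, G i x * φ x

/-- `t` is the trace on `Γ` of the `H¹(U)` function `f` with weak gradient `G`: the `L²(Γ)` limit
of the boundary values of smooth functions that converge to `f` in `H¹(U)`. -/
def IsTrace (U Γ : Set Plane) (f : Plane → ℂ) (G : Fin 2 → Plane → ℂ) (t : Plane → ℂ) : Prop :=
  MemLp t 2 (arcLength Γ) ∧ ∃ φ : ℕ → Plane → ℂ, (∀ n, IsTest (φ n)) ∧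
    Tendsto (fun n => eLpNorm (fun x => φ n x - f x) 2 (volume.restrict U)) atTop (𝓝 0) ∧
    (∀ i, Tendsto (fun n => eLpNorm (fun x => pderiv i (φ n) x - G i x) 2 (volume.restrict U))
      atTop (𝓝 0)) ∧
    Tendsto (fun n => eLpNorm (fun x => φ n x - t x) 2 (arcLength Γ)) atTop (𝓝 0)

/-- `ℓ` is the weak Laplacian in `U` of a function with weak gradient `G`. -/
def IsWeakLaplacian (U : Set Plane) (G : Fin 2 → Plane → ℂ) (ℓ : Plane → ℂ) : Prop :=
  MemLp ℓ 2 (volume.restrict U) ∧ ∀ φ, IsTest φ → tsupport φ ⊆ U →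
    ∫ x in U, ∑ i, G i x * pderiv i φ x = -∫ x in U, ℓ x * φ x

/-- `d ∈ L²(Γ)` is the outward normal derivative on `Γ = ∂U` of a function with weak gradient `G`
and weak Laplacian `ℓ`, in the usual sense for `H¹` functions whose Laplacian is in `L²`. -/
def IsNormalDeriv (U Γ : Set Plane) (G : Fin 2 → Plane → ℂ) (ℓ d : Plane → ℂ) : Prop :=
  MemLp d 2 (arcLength Γ) ∧ ∀ φ, IsTest φ →
    (∫ x in U, ∑ i, G i x * pderiv i φ x) + ∫ x in U, ℓ x * φ x
      = ∫ x, d x * φ x ∂(arcLength Γ)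

/-- The classical outward normal derivative on the boundary of `Ω` of a differentiable function. -/
def Configuration.dn (S : Configuration) (φ : Plane → ℂ) (x : Plane) : ℂ :=
  fderiv ℝ φ x (S.normal x)

/-- A function together with its weak gradient and its trace. -/
structure TracedField where
  fn : Plane → ℂ
  grad : Fin 2 → Plane → ℂ
  trace : Plane → ℂ

/-- A function together with its weak gradient, its trace and its normal derivative. -/
structure CauchyField extends TracedField where
  normalDeriv : Plane → ℂ

/-- `v` is an `H¹(Ω)` function with its weak gradient and its trace on `Γ`. -/
def Configuration.MemH1 (S : Configuration) (v : TracedField) : Prop :=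
  IsH1 S.Ω v.fn v.grad ∧ IsTrace S.Ω S.Γ v.fn v.grad v.trace

/-- The perturbation `u + ε φ` of `u` in the direction of a smooth `φ`. -/
def Configuration.perturb (S : Configuration) (u : CauchyField) (ε : ℝ) (φ : Plane → ℂ) :
    CauchyField where
  fn := fun x => u.fn x + ε * φ x
  grad := fun i x => u.grad i x + ε * pderiv i φ x
  trace := fun x => u.trace x + ε * φ x
  normalDeriv := fun x => u.normalDeriv x + ε * S.dn φ x

/-! ### The state problem -/

/-- The transmission coefficient `α = α₀ + i α₁` with `α₀ = 0` and `α₁ = (1 - K) / (1 + K)`. -/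
def alpha (K : ℝ) : ℂ := ⟨0, (1 - K) / (1 + K)⟩

/-- The incoming plane wave `A exp (i k x · (cos θ, sin θ))`. -/
def incoming (k A θ : ℝ) (x : Plane) : ℂ :=
  A * Complex.exp (Complex.I * k * ((x 0 * Real.cos θ + x 1 * Real.sin θ : ℝ) : ℂ))

/-- `u` is an `H¹(Ω)` solution, with a normal derivative in `L²(Γ)`, of the state problem. -/
structure IsStateSolution (S : Configuration) (k A θ K : ℝ) (u : CauchyField) : Prop where
  memH1 : S.MemH1 u.toTracedField
  helmholtz : IsWeakLaplacian S.Ω u.grad (fun x => -((k : ℂ) ^ 2 * u.fn x))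
  normalDeriv : IsNormalDeriv S.Ω S.Γ u.grad (fun x => -((k : ℂ) ^ 2 * u.fn x)) u.normalDeriv
  absorbing : ∀ᵐ x ∂(arcLength (S.Γ₁ ∪ S.Γ₅)), u.normalDeriv x + k * alpha K * u.trace x = 0
  periodic : ∀ᵐ x ∂(arcLength S.Γ₂), u.trace x = u.trace (x + S.period)
  sommerfeld : ∀ᵐ x ∂(arcLength S.Γ₄),
    (u.normalDeriv x - S.dn (incoming k A θ) x)
      - Complex.I * k * (u.trace x - incoming k A θ x) = 0

/-! ### The Lagrangian and its adjoint -/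

/-- The real inner product `(f, g) = Re ∫ f ḡ dμ` on complex functions. -/
def innerRe (μ : Measure Plane) (f g : Plane → ℂ) : ℝ := (∫ x, f x * conj (g x) ∂μ).re

/-- The tracking objective on the coast, as a functional of the boundary values of the state. -/
def objective (S : Configuration) (u₀ : Plane → ℂ) (u : CauchyField) : ℝ :=
  1 / 2 * innerRe (arcLength S.Γ₁) (fun x => u.trace x - u₀ x) (fun x => u.trace x - u₀ x)

/-- The Lagrangian of the tracking objective, with multipliers `v`, `v₁`, `v₂`, `v₃` for the
Helmholtz equation and the absorbing, lateral and radiation conditions. -/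
def lagrangian (S : Configuration) (k A θ K : ℝ) (u₀ : Plane → ℂ) (u : CauchyField)
    (v : TracedField) (v₁ v₂ v₃ : Plane → ℂ) : ℝ :=
  objective S u₀ u
    + ∑ i, innerRe (volume.restrict S.Ω) (u.grad i) (v.grad i)
    - k ^ 2 * innerRe (volume.restrict S.Ω) u.fn v.fn
    - innerRe (arcLength S.Γ) u.normalDeriv v.trace
    - innerRe (arcLength (S.Γ₁ ∪ S.Γ₅)) (fun x => u.normalDeriv x + k * alpha K * u.trace x) v₁
    + innerRe (arcLength S.Γ₂) u.trace v₂
    + innerRe (arcLength S.Γ₃) u.trace v₂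
    - innerRe (arcLength S.Γ₄)
        (fun x => (u.normalDeriv x - S.dn (incoming k A θ) x)
          - Complex.I * k * (u.trace x - incoming k A θ x)) v₃

/-- `v` is an adjoint at the state `u`: for suitable boundary multipliers, all the directional
derivatives of the Lagrangian with respect to `u` vanish at `u`. -/
def IsAdjoint (S : Configuration) (k A θ K : ℝ) (u₀ : Plane → ℂ) (u : CauchyField)
    (v : TracedField) : Prop :=
  ∃ v₁ v₂ v₃ : Plane → ℂ, MemLp v₁ 2 (arcLength (S.Γ₁ ∪ S.Γ₅)) ∧
    MemLp v₂ 2 (arcLength (S.Γ₂ ∪ S.Γ₃)) ∧ MemLp v₃ 2 (arcLength S.Γ₄) ∧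
    ∀ φ, IsTest φ →
      HasDerivAt (fun ε : ℝ => lagrangian S k A θ K u₀ (S.perturb u ε φ) v v₁ v₂ v₃) 0 0

/-- `v` solves the adjoint boundary value problem in strong form; `d` is its normal derivative. -/
def SolvesAdjointProblem (S : Configuration) (k K : ℝ) (u₀ : Plane → ℂ) (u : CauchyField)
    (v : TracedField) : Prop :=
  IsWeakLaplacian S.Ω v.grad (fun x => -((k : ℂ) ^ 2 * v.fn x)) ∧
  ∃ d : Plane → ℂ,
    IsNormalDeriv S.Ω S.Γ v.grad (fun x => -((k : ℂ) ^ 2 * v.fn x)) d ∧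
    (∀ᵐ x ∂(arcLength S.Γ₁), d x = -(u.trace x - u₀ x) + k * alpha K * v.trace x) ∧
    (∀ᵐ x ∂(arcLength S.Γ₅), d x = k * alpha K * v.trace x) ∧
    (∀ᵐ x ∂(arcLength S.Γ₄), d x = -(Complex.I * k * v.trace x)) ∧
    (∀ᵐ x ∂(arcLength (S.Γ₂ ∪ S.Γ₃)), v.trace x = 0)

end Helmholtz

end

/-!
The derivative of the Lagrangian in a smooth direction `φ` is the real part of a Green form: the
volume terms `∫_Ω (∇v · ∇φ̄ - k² v φ̄)`, minus a boundary function `traceCoeff` paired with `φ̄`,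
minus a boundary function `normalCoeff` paired with `∂φ̄/∂n`. On a Lipschitz domain such a form
vanishes for all `φ` only if the coefficient of the normal derivative vanishes almost everywhere.
To see this, test with boundary layers `δ η(h/δ) ψ`, where `h` is the signed vertical distance to a
smoothed boundary graph: as `δ → 0` they are uniformly small and their gradients are supported in
thin layers, while their normal derivatives on the boundary stay of order one. What remains is
Green's formula, which says that `-Δv = k² v` and that `traceCoeff` is the normal derivative of
`v`. Reading off both coefficients on each `Γᵢ` gives the boundary conditions, together with
`v₁ = -v`, `v₃ = -v` and `v₂ = -∂v/∂n`.
-/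

noncomputable section

namespace Helmholtz

/-! ### Graph charts -/

/-- The `i`-th coordinate after the rotation `R`, as a continuous linear functional. -/
def rotCoord (R : Plane ≃ₗᵢ[ℝ] Plane) (i : Fin 2) : Plane →L[ℝ] ℝ :=
  (EuclideanSpace.proj i : Plane →L[ℝ] ℝ).comp
    (R.toContinuousLinearEquiv : Plane →L[ℝ] Plane)

/-- The vector with prescribed coordinates after the rotation `R`. -/
def rotVec (R : Plane ≃ₗᵢ[ℝ] Plane) (a b : ℝ) : Plane := R.symm !₂[a, b]

/-- The signed vertical distance from `x` to the graph of `g`, in the coordinates centred at `p`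
and rotated by `R`. It is negative below the graph. -/
def graphHeight (p : Plane) (R : Plane ≃ₗᵢ[ℝ] Plane) (g : ℝ → ℝ) (x : Plane) : ℝ :=
  rotCoord R 1 (x - p) - g (rotCoord R 0 (x - p))

/-- On the open set `V`, the set `U` lies strictly below the graph of the Lipschitz function `g`
in the coordinates centred at `p` and rotated by `R`. -/
structure IsGraphChart (U V : Set Plane) (p : Plane) (R : Plane ≃ₗᵢ[ℝ] Plane) (g : ℝ → ℝ)
    (C : NNReal) : Prop where
  isOpen : IsOpen V
  lipschitz : LipschitzWith C g
  mem_iff : ∀ z ∈ V, z ∈ U ↔ graphHeight p R g z < 0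

section RotatedCoordinates

variable (R : Plane ≃ₗᵢ[ℝ] Plane)

theorem rotCoord_apply (i : Fin 2) (x : Plane) : rotCoord R i x = (R x) i := rfl

theorem inner_eq_rotCoord (x y : Plane) :
    inner ℝ x y = rotCoord R 0 x * rotCoord R 0 y + rotCoord R 1 x * rotCoord R 1 y := by
  rw [← R.inner_map_map x y, PiLp.inner_apply, Fin.sum_univ_two]
  simp only [rotCoord_apply, RCLike.inner_apply, conj_trivial, mul_comm]

theorem abs_rotCoord_le (i : Fin 2) (x : Plane) : |rotCoord R i x| ≤ ‖x‖ := by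
  rw [rotCoord_apply, ← R.norm_map x]
  exact PiLp.norm_apply_le (R x) i

theorem norm_rotCoord_le (i : Fin 2) : ‖rotCoord R i‖ ≤ 1 :=
  ContinuousLinearMap.opNorm_le_bound _ zero_le_one fun x => by
    simpa using abs_rotCoord_le R i x

@[simp] theorem rotCoord_zero_rotVec (a b : ℝ) : rotCoord R 0 (rotVec R a b) = a := by
  simp [rotCoord_apply, rotVec]

@[simp] theorem rotCoord_one_rotVec (a b : ℝ) : rotCoord R 1 (rotVec R a b) = b := by
  simp [rotCoord_apply, rotVec]

theorem rotVec_rotCoord (x : Plane) : rotVec R (rotCoord R 0 x) (rotCoord R 1 x) = x := by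
  apply R.injective
  ext i
  fin_cases i <;> simp [rotCoord_apply, rotVec]

theorem rotVec_sub_rotVec (a b a' b' : ℝ) :
    rotVec R a b - rotVec R a' b' = rotVec R (a - a') (b - b') := by
  rw [← rotVec_rotCoord R (rotVec R a b - rotVec R a' b')]
  simp only [map_sub, rotCoord_zero_rotVec, rotCoord_one_rotVec]

theorem norm_rotVec_le (a b : ℝ) : ‖rotVec R a b‖ ≤ |a| + |b| := by
  rw [rotVec, R.symm.norm_map, EuclideanSpace.norm_eq, Fin.sum_univ_two]
  refine Real.sqrt_le_iff.2 ⟨by positivity, ?_⟩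
  simp only [Real.norm_eq_abs, Matrix.cons_val_zero, Matrix.cons_val_one]
  nlinarith [mul_nonneg (abs_nonneg a) (abs_nonneg b)]

theorem continuous_rotVec : Continuous fun q : ℝ × ℝ => rotVec R q.1 q.2 := by
  unfold rotVec
  fun_prop

theorem rotCoord_trans_neg (i : Fin 2) (x : Plane) :
    rotCoord (R.trans (LinearIsometryEquiv.neg ℝ)) i x = -rotCoord R i x := by
  simp [rotCoord_apply]

end RotatedCoordinates

section GraphHeight

variable {p : Plane} {R : Plane ≃ₗᵢ[ℝ] Plane} {g : ℝ → ℝ}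

theorem continuous_graphHeight (hg : Continuous g) : Continuous (graphHeight p R g) := by
  unfold graphHeight
  fun_prop

theorem graphHeight_add_rotVec (z : Plane) (s : ℝ) :
    graphHeight p R g (z + rotVec R 0 s) = graphHeight p R g z + s := by
  simp only [graphHeight, add_sub_right_comm z, map_add, rotCoord_zero_rotVec,
    rotCoord_one_rotVec, add_zero]
  ring

theorem graphHeight_trans_neg (z : Plane) :
    graphHeight p (R.trans (LinearIsometryEquiv.neg ℝ)) (fun t => -g (-t)) z
      = -graphHeight p R g z := by
  simp only [graphHeight, rotCoord_trans_neg, neg_neg]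
  ring

end GraphHeight

namespace IsGraphChart

variable {U V : Set Plane} {p : Plane} {R : Plane ≃ₗᵢ[ℝ] Plane} {g : ℝ → ℝ} {C : NNReal}

theorem mem_closure_iff (h : IsGraphChart U V p R g C) {z : Plane} (hz : z ∈ V) :
    z ∈ closure U ↔ graphHeight p R g z ≤ 0 := by
  refine ⟨fun hcl => ?_, fun hle => ?_⟩
  · by_contra! hpos
    have habove : IsOpen {y | 0 < graphHeight p R g y} :=
      isOpen_lt continuous_const (continuous_graphHeight h.lipschitz.continuous)
    obtain ⟨y, ⟨hy, hyV⟩, hyU⟩ :=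
      _root_.mem_closure_iff.1 hcl _ (habove.inter h.isOpen) ⟨hpos, hz⟩
    exact lt_asymm hy ((h.mem_iff y hyV).1 hyU)
  · have hcont : Continuous fun s : ℝ => z + rotVec R 0 s :=
      continuous_const.add ((continuous_rotVec R).comp (Continuous.prodMk_right 0))
    have hzero : rotVec R 0 0 = 0 := by simpa using rotVec_rotCoord R 0
    have hdown : Tendsto (fun s : ℝ => z + rotVec R 0 s) (𝓝[<] 0) (𝓝 z) := by
      simpa [hzero] using (hcont.tendsto 0).mono_left nhdsWithin_le_nhds
    refine mem_closure_of_tendsto hdown ?_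
    filter_upwards [hdown (h.isOpen.mem_nhds hz), self_mem_nhdsWithin] with s hsV hs
    rw [h.mem_iff _ hsV, graphHeight_add_rotVec]
    exact add_neg_of_nonpos_of_neg hle hs

theorem mem_frontier_iff (h : IsGraphChart U V p R g C) (hU : IsOpen U) {z : Plane}
    (hz : z ∈ V) : z ∈ frontier U ↔ graphHeight p R g z = 0 := by
  rw [hU.frontier_eq, Set.mem_sdiff, h.mem_closure_iff hz, h.mem_iff z hz, not_lt, le_antisymm_iff]

theorem congr (h : IsGraphChart U V p R g C) {W U' : Set Plane} (hW : IsOpen W)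
    (hWU : ∀ z ∈ W, z ∈ U' ↔ z ∈ U) : IsGraphChart U' (V ∩ W) p R g C :=
  ⟨h.isOpen.inter hW, h.lipschitz, fun z hz => (hWU z hz.2).trans (h.mem_iff z hz.1)⟩

theorem compl_closure (h : IsGraphChart U V p R g C) :
    IsGraphChart (closure U)ᶜ V p (R.trans (LinearIsometryEquiv.neg ℝ)) (fun t => -g (-t)) C where
  isOpen := h.isOpen
  lipschitz := LipschitzWith.of_dist_le_mul fun x y => by
    simpa only [dist_neg_neg] using h.lipschitz.dist_le_mul (-x) (-y)
  mem_iff z hz := by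
    rw [Set.mem_compl_iff, h.mem_closure_iff hz, graphHeight_trans_neg, not_le, neg_lt_zero]

end IsGraphChart

theorem hasLipschitzBoundary_iff_exists_isGraphChart {U : Set Plane} :
    HasLipschitzBoundary U ↔
      ∀ p ∈ frontier U, ∃ V R g C, p ∈ V ∧ IsGraphChart U V p R g C := by
  refine forall₂_congr fun p _ => ⟨?_, ?_⟩
  · rintro ⟨R, g, C, hg, hev⟩
    obtain ⟨V, hV, hVo, hpV⟩ := eventually_nhds_iff.1 hev
    exact ⟨V, R, g, C, hpV, hVo, hg, fun z hz => (hV z hz).trans sub_neg.symm⟩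
  · rintro ⟨V, R, g, C, hpV, h⟩
    refine ⟨R, g, C, h.lipschitz, ?_⟩
    filter_upwards [h.isOpen.mem_nhds hpV] with z hz
    exact (h.mem_iff z hz).trans sub_neg

namespace HasLipschitzBoundary

variable {U : Set Plane}

theorem compl_closure (hU : HasLipschitzBoundary U) : HasLipschitzBoundary (closure U)ᶜ := by
  rw [hasLipschitzBoundary_iff_exists_isGraphChart] at hU ⊢
  intro p hp
  rw [frontier_compl] at hp
  obtain ⟨V, R, g, C, hpV, h⟩ := hU p (frontier_closure_subset hp)
  exact ⟨V, _, _, C, hpV, h.compl_closure⟩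

theorem frontier_compl_closure (hU : HasLipschitzBoundary U) (ho : IsOpen U) :
    frontier (closure U)ᶜ = frontier U := by
  refine Set.Subset.antisymm ?_ fun p hp => ?_
  · rw [frontier_compl]
    exact frontier_closure_subset
  · obtain ⟨V, R, g, C, hpV, h⟩ := hasLipschitzBoundary_iff_exists_isGraphChart.1 hU p hp
    rw [h.compl_closure.mem_frontier_iff isClosed_closure.isOpen_compl hpV,
      graphHeight_trans_neg, neg_eq_zero]
    exact (h.mem_frontier_iff ho hpV).1 hp

end HasLipschitzBoundary

theorem frontier_inter_eq_union {X : Type*} [TopologicalSpace X] {U W : Set X} (hU : IsOpen U)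
    (hW : IsOpen W) (hUW : frontier U ⊆ W) (hWU : frontier W ⊆ U) :
    frontier (U ∩ W) = frontier U ∪ frontier W := by
  refine Set.Subset.antisymm ((frontier_inter_subset U W).trans
    (Set.union_subset_union Set.inter_subset_left Set.inter_subset_right))
    (Set.union_subset (fun p hp => ?_) fun p hp => ?_)
  · exact ((frontier_inter_open_inter hW).ge ⟨hp, hUW hp⟩).1
  · rw [Set.inter_comm]
    exact ((frontier_inter_open_inter hU).ge ⟨hp, hWU hp⟩).1

theorem HasLipschitzBoundary.inter {U W : Set Plane} (hU : HasLipschitzBoundary U)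
    (hW : HasLipschitzBoundary W) (hUo : IsOpen U) (hWo : IsOpen W) (hUW : frontier U ⊆ W)
    (hWU : frontier W ⊆ U) : HasLipschitzBoundary (U ∩ W) := by
  rw [hasLipschitzBoundary_iff_exists_isGraphChart] at hU hW ⊢
  rw [frontier_inter_eq_union hUo hWo hUW hWU]
  rintro p (hp | hp)
  · obtain ⟨V, R, g, C, hpV, h⟩ := hU p hp
    exact ⟨V ∩ W, R, g, C, ⟨hpV, hUW hp⟩, h.congr hWo fun _ hz => and_iff_left hz⟩
  · obtain ⟨V, R, g, C, hpV, h⟩ := hW p hp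
    exact ⟨V ∩ U, R, g, C, ⟨hpV, hWU hp⟩, h.congr hUo fun _ hz => and_iff_right hz⟩

/-! ### The outward normal of a region below a graph -/

/-- The length of the normal `(-s, 1)` of a graph with slope `s`. -/
def slopeNorm (s : ℝ) : ℝ := Real.sqrt (1 + s ^ 2)

/-- The upward unit normal of a graph with slope `s`, in the coordinates rotated by `R`. -/
def graphNormal (R : Plane ≃ₗᵢ[ℝ] Plane) (s : ℝ) : Plane :=
  rotVec R (-s / slopeNorm s) (1 / slopeNorm s)

/-- The derivative of `graphHeight` at a point where the graph has slope `s`. -/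
def graphConormal (R : Plane ≃ₗᵢ[ℝ] Plane) (s : ℝ) : Plane →L[ℝ] ℝ :=
  rotCoord R 1 - s • rotCoord R 0

theorem slopeNorm_pos (s : ℝ) : 0 < slopeNorm s := Real.sqrt_pos.2 (by positivity)

theorem slopeNorm_sq (s : ℝ) : slopeNorm s ^ 2 = 1 + s ^ 2 := Real.sq_sqrt (by positivity)

theorem measurable_slopeNorm : Measurable slopeNorm := by
  unfold slopeNorm
  fun_prop

theorem slopeNorm_le_slopeNorm {s t : ℝ} (h : |s| ≤ |t|) : slopeNorm s ≤ slopeNorm t :=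
  Real.sqrt_le_sqrt (by linarith [sq_le_sq.2 h])

section GraphNormal

variable (R : Plane ≃ₗᵢ[ℝ] Plane)

theorem measurable_graphNormal : Measurable (graphNormal R) :=
  (continuous_rotVec R).measurable.comp
    ((measurable_neg.div measurable_slopeNorm).prodMk (measurable_const.div measurable_slopeNorm))

theorem norm_graphConormal_le (s : ℝ) : ‖graphConormal R s‖ ≤ 1 + |s| := by
  refine (norm_sub_le _ _).trans (add_le_add (norm_rotCoord_le R 1) ?_)
  rw [norm_smul]
  exact mul_le_of_le_one_right (norm_nonneg s) (norm_rotCoord_le R 0)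

theorem graphConormal_apply_eq_mul_inner (s : ℝ) (y : Plane) :
    graphConormal R s y = slopeNorm s * inner ℝ y (graphNormal R s) := by
  have := (slopeNorm_pos s).ne'
  rw [inner_eq_rotCoord R, graphNormal, rotCoord_zero_rotVec, rotCoord_one_rotVec]
  simp only [graphConormal, sub_apply, smul_apply, smul_eq_mul]
  field_simp
  ring

theorem norm_graphNormal (s : ℝ) : ‖graphNormal R s‖ = 1 := by
  have := (slopeNorm_pos s).ne'
  rw [← sq_eq_sq₀ (norm_nonneg _) zero_le_one, ← real_inner_self_eq_norm_sq, inner_eq_rotCoord R,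
    graphNormal, rotCoord_zero_rotVec, rotCoord_one_rotVec]
  field_simp
  rw [slopeNorm_sq, add_comm]

theorem graphConormal_graphNormal (s : ℝ) : graphConormal R s (graphNormal R s) = slopeNorm s := by
  rw [graphConormal_apply_eq_mul_inner, real_inner_self_eq_norm_sq, norm_graphNormal, one_pow,
    mul_one]

end GraphNormal

theorem hasFDerivAt_graphHeight {p : Plane} {R : Plane ≃ₗᵢ[ℝ] Plane} {g : ℝ → ℝ} {s : ℝ}
    {x : Plane} (hg : HasDerivAt g s (rotCoord R 0 (x - p))) :
    HasFDerivAt (graphHeight p R g) (graphConormal R s) x := by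
  have hcoord (i : Fin 2) : HasFDerivAt (fun x : Plane => rotCoord R i (x - p)) (rotCoord R i) x :=
    (rotCoord R i).hasFDerivAt.comp x ((hasFDerivAt_id x).sub_const p)
  exact (hcoord 1).sub (hg.comp_hasFDerivAt x (hcoord 0))

theorem contDiff_graphHeight {p : Plane} {R : Plane ≃ₗᵢ[ℝ] Plane} {g : ℝ → ℝ}
    (hg : ContDiff ℝ ∞ g) : ContDiff ℝ ∞ (graphHeight p R g) := by
  have hcoord (i : Fin 2) : ContDiff ℝ ∞ fun x : Plane => rotCoord R i (x - p) :=
    (rotCoord R i).contDiff.comp (contDiff_id.sub contDiff_const)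
  exact (hcoord 1).sub (hg.comp (hcoord 0))

theorem IsOutwardNormalAt.unique {U : Set Plane} {x ν ν' : Plane} (h : IsOutwardNormalAt U x ν)
    (h' : IsOutwardNormalAt U x ν') : ν = ν' := by
  by_contra hne
  have hlt : inner ℝ ν ν' < 1 := (inner_lt_one_iff_real_of_norm_eq_one h.1 h'.1).2 hne
  -- Moving from `x` in the direction `ν' - ν` enters `U` according to `ν` and leaves it
  -- according to `ν'`.
  set e : Plane := ν' - ν
  have he : inner ℝ e ν = inner ℝ ν ν' - 1 := by
    simp [e, inner_sub_left, h.1, real_inner_comm]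
  have he' : inner ℝ e ν' = 1 - inner ℝ ν ν' := by
    simp [e, inner_sub_left, h'.1]
  have hpos : 0 < ‖e‖ := norm_pos_iff.2 (sub_ne_zero.2 (Ne.symm hne))
  set ε := (1 - inner ℝ ν ν') / (2 * ‖e‖) with hε
  have hε0 : 0 < ε := div_pos (by linarith) (by positivity)
  have hεe : ε * ‖e‖ = (1 - inner ℝ ν ν') / 2 := by rw [hε]; field_simp
  have hray : Tendsto (fun s : ℝ => x + s • e) (𝓝[>] 0) (𝓝 x) := by
    have hcont : Continuous fun s : ℝ => x + s • e := by fun_prop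
    simpa using (hcont.tendsto 0).mono_left nhdsWithin_le_nhds
  obtain ⟨s, hin, hout, hs : 0 < s⟩ := ((hray.eventually (h.2 ε hε0)).and
    ((hray.eventually (h'.2 ε hε0)).and self_mem_nhdsWithin)).exists
  have hn : ε * ‖s • e‖ = s * ((1 - inner ℝ ν ν') / 2) := by
    rw [norm_smul, Real.norm_of_nonneg hs.le, ← hεe]; ring
  simp only [add_sub_cancel_left, real_inner_smul_left, hn, he, he'] at hin hout
  exact hout.2 (by nlinarith) (hin.1 (by nlinarith))

theorem IsOutwardNormalAt.outwardNormal_eq {U : Set Plane} {x ν : Plane}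
    (h : IsOutwardNormalAt U x ν) : outwardNormal U x = ν := by
  have hex : ∃ ν, IsOutwardNormalAt U x ν := ⟨ν, h⟩
  rw [outwardNormal, dif_pos hex]
  exact hex.choose_spec.unique h

theorem norm_outwardNormal_le (U : Set Plane) (x : Plane) : ‖outwardNormal U x‖ ≤ 1 := by
  unfold outwardNormal
  split_ifs with h
  · exact h.choose_spec.1.le
  · simp

theorem norm_fderiv_outwardNormal_le (U : Set Plane) (φ : Plane → ℂ) (x : Plane) :
    ‖fderiv ℝ φ x (outwardNormal U x)‖ ≤ ‖fderiv ℝ φ x‖ :=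
  (ContinuousLinearMap.le_opNorm _ _).trans
    (mul_le_of_le_one_right (norm_nonneg _) (norm_outwardNormal_le U x))

theorem isOutwardNormalAt_of_hasFDerivAt {U : Set Plane} {f : Plane → ℝ} {L : Plane →L[ℝ] ℝ}
    {x ν : Plane} {m : ℝ} (hU : ∀ᶠ y in 𝓝 x, y ∈ U ↔ f y < 0) (hf : HasFDerivAt f L x)
    (hx : f x = 0) (hm : 0 < m) (hL : ∀ y, L y = m * inner ℝ y ν) (hν : ‖ν‖ = 1) :
    IsOutwardNormalAt U x ν := by
  refine ⟨hν, fun ε hε => ?_⟩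
  filter_upwards [hU, (hasFDerivAt_iff_isLittleO.1 hf).def (mul_pos hm hε)] with y hyU hy
  rw [hx, sub_zero, hL, Real.norm_eq_abs, mul_assoc, abs_le] at hy
  rw [hyU]
  refine ⟨fun hlt => ?_, fun hlt => not_lt.2 ?_⟩
  · linarith [mul_lt_mul_of_pos_left hlt hm]
  · linarith [mul_lt_mul_of_pos_left hlt hm]

theorem IsGraphChart.isOutwardNormalAt {U V : Set Plane} {p : Plane} {R : Plane ≃ₗᵢ[ℝ] Plane}
    {g : ℝ → ℝ} {C : NNReal} (h : IsGraphChart U V p R g C) {x : Plane} (hx : x ∈ V)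
    (hxg : graphHeight p R g x = 0) (hd : DifferentiableAt ℝ g (rotCoord R 0 (x - p))) :
    IsOutwardNormalAt U x (graphNormal R (deriv g (rotCoord R 0 (x - p)))) :=
  isOutwardNormalAt_of_hasFDerivAt
    (eventually_of_mem (h.isOpen.mem_nhds hx) h.mem_iff)
    (hasFDerivAt_graphHeight hd.hasDerivAt) hxg (slopeNorm_pos _)
    (graphConormal_apply_eq_mul_inner R _) (norm_graphNormal R _)

/-! ### Arc length on Lipschitz boundaries -/

/-- The parametrization of the graph of `g` by its abscissa. -/
def graphParam (p : Plane) (R : Plane ≃ₗᵢ[ℝ] Plane) (g : ℝ → ℝ) (t : ℝ) : Plane :=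
  p + rotVec R t (g t)

section Graph

variable {p : Plane} {R : Plane ≃ₗᵢ[ℝ] Plane} {g : ℝ → ℝ} {C : NNReal} {s : Set Plane}

theorem lipschitzWith_graphParam (hg : LipschitzWith C g) :
    LipschitzWith (1 + C) (graphParam p R g) := by
  refine LipschitzWith.of_dist_le_mul fun t t' => ?_
  calc dist (graphParam p R g t) (graphParam p R g t')
      = ‖rotVec R (t - t') (g t - g t')‖ := by
        rw [dist_eq_norm, graphParam, graphParam, add_sub_add_left_eq_sub, rotVec_sub_rotVec]
    _ ≤ dist t t' + dist (g t) (g t') := norm_rotVec_le R _ _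
    _ ≤ dist t t' + C * dist t t' := by gcongr; exact hg.dist_le_mul t t'
    _ = (1 + C : NNReal) * dist t t' := by push_cast; ring

theorem graphParam_rotCoord {z : Plane} (hz : graphHeight p R g z = 0) :
    graphParam p R g (rotCoord R 0 (z - p)) = z := by
  rw [graphParam, ← sub_eq_zero.1 hz, rotVec_rotCoord, add_sub_cancel]

theorem hausdorffMeasure_graph_lt_top (hg : LipschitzWith C g) (hb : Bornology.IsBounded s)
    (hs : ∀ z ∈ s, graphHeight p R g z = 0) :
    (Measure.hausdorffMeasure 1 : Measure Plane) s < ⊤ := by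
  obtain ⟨r, hr⟩ := hb.subset_closedBall p
  have hsub : s ⊆ graphParam p R g '' Set.Icc (-r) r := fun z hz =>
    ⟨rotCoord R 0 (z - p),
      abs_le.1 ((abs_rotCoord_le R 0 _).trans (mem_closedBall_iff_norm.1 (hr hz))),
      graphParam_rotCoord (hs z hz)⟩
  refine (measure_mono hsub).trans_lt
    (((lipschitzWith_graphParam hg).hausdorffMeasure_image_le zero_le_one _).trans_lt ?_)
  rw [hausdorffMeasure_real, Real.volume_Icc]
  exact ENNReal.mul_lt_top (by simp) ENNReal.ofReal_lt_top

theorem ae_arcLength_of_ae_abscissa (hg : LipschitzWith C g) (hsm : MeasurableSet s)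
    (hs : ∀ z ∈ s, graphHeight p R g z = 0) {P : ℝ → Prop} (hP : ∀ᵐ t, P t) :
    ∀ᵐ z ∂arcLength s, P (rotCoord R 0 (z - p)) := by
  rw [arcLength, ae_restrict_iff' hsm]
  refine measure_mono_null (t := graphParam p R g '' {t | ¬ P t}) (fun z hz => ?_) ?_
  · obtain ⟨hzs, hzP⟩ := Classical.not_imp.1 hz
    exact ⟨_, hzP, graphParam_rotCoord (hs z hzs)⟩
  · have := (lipschitzWith_graphParam (p := p) (R := R) hg).hausdorffMeasure_image_le
      zero_le_one {t | ¬ P t}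
    rwa [hausdorffMeasure_real, (ae_iff.1 hP : volume {t | ¬ P t} = 0), mul_zero,
      nonpos_iff_eq_zero] at this

end Graph

theorem arcLength_mono {s t : Set Plane} (h : s ⊆ t) : arcLength s ≤ arcLength t :=
  Measure.restrict_mono_set _ h

namespace IsGraphChart

variable {U V : Set Plane} {p : Plane} {R : Plane ≃ₗᵢ[ℝ] Plane} {g : ℝ → ℝ} {C : NNReal}

theorem ae_of_ae_abscissa (h : IsGraphChart U V p R g C) (hU : IsOpen U) {P : ℝ → Prop}
    (hP : ∀ᵐ t, P t) : ∀ᵐ x ∂arcLength (V ∩ frontier U), P (rotCoord R 0 (x - p)) :=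
  ae_arcLength_of_ae_abscissa h.lipschitz
    (h.isOpen.measurableSet.inter isClosed_frontier.measurableSet)
    (fun _ hz => (h.mem_frontier_iff hU hz.1).1 hz.2) hP

theorem ae_outwardNormal_eq (h : IsGraphChart U V p R g C) (hU : IsOpen U) :
    ∀ᵐ x ∂arcLength (V ∩ frontier U),
      outwardNormal U x = graphNormal R (deriv g (rotCoord R 0 (x - p))) := by
  filter_upwards [h.ae_of_ae_abscissa hU h.lipschitz.ae_differentiableAt_real,
    ae_restrict_mem (h.isOpen.measurableSet.inter isClosed_frontier.measurableSet)] with x hx hxV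
  exact (h.isOutwardNormalAt hxV.1 ((h.mem_frontier_iff hU hxV.1).1 hxV.2) hx).outwardNormal_eq

end IsGraphChart

/-- A bounded open set with Lipschitz boundary. -/
structure IsLipschitzDomain (U : Set Plane) : Prop where
  isOpen : IsOpen U
  isBounded : Bornology.IsBounded U
  lipschitz : HasLipschitzBoundary U

namespace IsLipschitzDomain

variable {U : Set Plane}

theorem frontier_induction (hU : IsLipschitzDomain U) {P : Set Plane → Prop} (empty : P ∅)
    (mono : ∀ ⦃s t⦄, s ⊆ t → P t → P s) (union : ∀ ⦃s t⦄, P s → P t → P (s ∪ t))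
    (chart : ∀ ⦃V p R g C⦄, IsGraphChart U V p R g C → P (V ∩ frontier U)) :
    P (frontier U) := by
  have hcompact : IsCompact (frontier U) :=
    Metric.isCompact_of_isClosed_isBounded isClosed_frontier
      (hU.isBounded.closure.subset frontier_subset_closure)
  refine hcompact.induction_on empty mono union fun p hp => ?_
  obtain ⟨V, R, g, C, hpV, h⟩ := hasLipschitzBoundary_iff_exists_isGraphChart.1 hU.lipschitz p hp
  exact ⟨V ∩ frontier U, inter_mem (mem_nhdsWithin_of_mem_nhds (h.isOpen.mem_nhds hpV))
    self_mem_nhdsWithin, chart h⟩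

theorem isFiniteMeasure_volume_restrict (hU : IsLipschitzDomain U) :
    IsFiniteMeasure (volume.restrict U) :=
  isFiniteMeasure_restrict.2 hU.isBounded.measure_lt_top.ne

theorem isFiniteMeasure_arcLength_frontier (hU : IsLipschitzDomain U) :
    IsFiniteMeasure (arcLength (frontier U)) := by
  refine ⟨?_⟩
  rw [arcLength, Measure.restrict_apply_univ]
  refine hU.frontier_induction (P := fun s => Measure.hausdorffMeasure 1 s < ⊤) ?_
    (fun s t hst ht => (measure_mono hst).trans_lt ht) (fun s t => measure_union_lt_top)
    fun V p R g C h => ?_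
  · simp only [measure_empty, ENNReal.zero_lt_top]
  · exact hausdorffMeasure_graph_lt_top h.lipschitz
      ((hU.isBounded.closure.subset frontier_subset_closure).subset Set.inter_subset_right)
      fun z hz => (h.mem_frontier_iff hU.isOpen hz.1).1 hz.2

theorem aestronglyMeasurable_outwardNormal (hU : IsLipschitzDomain U) :
    AEStronglyMeasurable (outwardNormal U) (arcLength (frontier U)) := by
  refine hU.frontier_induction
    (P := fun s => AEStronglyMeasurable (outwardNormal U) (arcLength s)) ?_
    (fun s t hst ht => ht.mono_measure (arcLength_mono hst))
    (fun s t hs ht => aestronglyMeasurable_union_iff.2 ⟨hs, ht⟩) fun V p R g C h => ?_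
  · simp only [arcLength, Measure.restrict_empty, aestronglyMeasurable_zero_measure]
  · have hmeas : Measurable fun x : Plane => graphNormal R (deriv g (rotCoord R 0 (x - p))) :=
      (measurable_graphNormal R).comp ((measurable_deriv g).comp (by fun_prop))
    exact hmeas.aestronglyMeasurable.congr (EventuallyEq.symm (h.ae_outwardNormal_eq hU.isOpen))

theorem aestronglyMeasurable_fderiv_outwardNormal (hU : IsLipschitzDomain U) {φ : Plane → ℂ}
    (hφ : ContDiff ℝ ∞ φ) :
    AEStronglyMeasurable (fun x => fderiv ℝ φ x (outwardNormal U x)) (arcLength (frontier U)) :=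
  (isBoundedBilinearMap_apply (𝕜 := ℝ) (E := Plane) (F := ℂ)).continuous.comp_aestronglyMeasurable
    ((hφ.continuous_fderiv (by simp)).aestronglyMeasurable.prodMk
      hU.aestronglyMeasurable_outwardNormal)

end IsLipschitzDomain

/-! ### Mollification of Lipschitz functions -/

section Mollification

variable {F : Type*} [NormedAddCommGroup F] [NormedSpace ℝ F] {g : ℝ → F} {C : NNReal}

theorem norm_convolution_normed_le (κ : ContDiffBump (0 : ℝ)) {M : ℝ} (hM : ∀ t, ‖g t‖ ≤ M)
    (t : ℝ) :
    ‖convolution (κ.normed volume) g (ContinuousLinearMap.lsmul ℝ ℝ) volume t‖ ≤ M := by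
  refine (norm_integral_le_of_norm_le ((κ.integrable_normed (μ := volume)).mul_const M)
    (Eventually.of_forall fun s => ?_)).trans_eq ?_
  · rw [ContinuousLinearMap.lsmul_apply, norm_smul, Real.norm_of_nonneg (κ.nonneg_normed s)]
    exact mul_le_mul_of_nonneg_left (hM _) (κ.nonneg_normed s)
  · rw [integral_mul_const, κ.integral_normed, one_mul]

variable [FiniteDimensional ℝ F]

theorem hasDerivAt_convolution_of_lipschitz {κ : ℝ → ℝ} (hκ : Continuous κ)
    (hκc : HasCompactSupport κ) (hg : LipschitzWith C g) (t : ℝ) :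
    HasDerivAt (convolution κ g (ContinuousLinearMap.lsmul ℝ ℝ) volume)
      (convolution κ (deriv g) (ContinuousLinearMap.lsmul ℝ ℝ) volume t) t := by
  have hgc := hg.continuous
  have hcont (x : ℝ) : Continuous fun s => κ s • g (x - s) := by fun_prop
  have hlip (s : ℝ) : LipschitzOnWith (Real.nnabs (‖κ s‖ * C)) (fun x => κ s • g (x - s))
      Set.univ := by
    refine LipschitzOnWith.of_dist_le_mul fun x _ y _ => ?_
    rw [dist_smul₀, Real.coe_nnabs, abs_of_nonneg (by positivity), mul_assoc]
    gcongr
    simpa using hg.dist_le_mul (x - s) (y - s)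
  have hderiv : ∀ᵐ s, HasDerivAt (fun x => κ s • g (x - s)) (κ s • deriv g (t - s)) t := by
    filter_upwards [(Measure.measurePreserving_sub_left (volume : Measure ℝ)
      t).quasiMeasurePreserving.ae hg.ae_differentiableAt_real] with s hs
    exact (hs.hasDerivAt.comp_sub_const t s).const_smul (κ s)
  exact (hasDerivAt_integral_of_dominated_loc_of_lip (F := fun x s => κ s • g (x - s))
    (F' := fun s => κ s • deriv g (t - s)) (bound := fun s => ‖κ s‖ * C) univ_mem
    (Eventually.of_forall fun x => (hcont x).aestronglyMeasurable)
    ((hcont t).integrable_of_hasCompactSupport hκc.smul_right)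
    (hκ.aestronglyMeasurable.smul ((stronglyMeasurable_deriv g).comp_measurable
      (measurable_const_sub t)).aestronglyMeasurable)
    (Eventually.of_forall hlip)
    ((hκ.integrable_of_hasCompactSupport hκc).norm.mul_const _) hderiv).2

theorem exists_smooth_approx_of_lipschitz (hg : LipschitzWith C g) {ε : ℕ → ℝ}
    (hε : ∀ n, 0 < ε n) (hε0 : Tendsto ε atTop (𝓝 0)) :
    ∃ G : ℕ → ℝ → F, (∀ n, ContDiff ℝ ∞ (G n)) ∧ (∀ n t, ‖G n t - g t‖ ≤ C * ε n) ∧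
      (∀ n t, ‖deriv (G n) t‖ ≤ C) ∧
      ∀ᵐ t, Tendsto (fun n => deriv (G n) t) atTop (𝓝 (deriv g t)) := by
  let κ (n : ℕ) : ContDiffBump (0 : ℝ) := ⟨ε n / 2, ε n, half_pos (hε n), half_lt_self (hε n)⟩
  let G (n : ℕ) : ℝ → F :=
    convolution ((κ n).normed volume) g (ContinuousLinearMap.lsmul ℝ ℝ) volume
  have hbound (t : ℝ) : ‖deriv g t‖ ≤ C := norm_deriv_le_of_lipschitz hg
  have hderiv (n : ℕ) (t : ℝ) : deriv (G n) t =
      convolution ((κ n).normed volume) (deriv g) (ContinuousLinearMap.lsmul ℝ ℝ) volume t :=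
    (hasDerivAt_convolution_of_lipschitz (κ n).continuous_normed (κ n).hasCompactSupport_normed
      hg t).deriv
  refine ⟨G, fun n => ?_, fun n t => ?_, fun n t => ?_, ?_⟩
  · exact (κ n).hasCompactSupport_normed.contDiff_convolution_left _ (κ n).contDiff_normed
      hg.continuous.locallyIntegrable
  · rw [← dist_eq_norm]
    refine ContDiffBump.dist_normed_convolution_le hg.continuous.aestronglyMeasurable fun x hx => ?_
    exact (hg.dist_le_mul x t).trans (mul_le_mul_of_nonneg_left (Metric.mem_ball.1 hx).le C.2)
  · rw [hderiv]
    exact norm_convolution_normed_le (κ n) hbound t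
  · have hint : LocallyIntegrable (deriv g) volume :=
      (locallyIntegrable_const (C : ℝ)).mono (stronglyMeasurable_deriv g).aestronglyMeasurable
        (Eventually.of_forall fun t => by simpa using hbound t)
    simp only [hderiv]
    refine ContDiffBump.ae_convolution_tendsto_right_of_locallyIntegrable (K := 2) hε0 ?_ hint
    exact Eventually.of_forall fun n => (mul_div_cancel₀ (ε n) two_ne_zero).ge

theorem exists_smooth_approx_isLittleO_of_lipschitz (hg : LipschitzWith C g) {δ : ℕ → ℝ}
    (hδ : Tendsto δ atTop (𝓝 0)) (hδ0 : ∀ n, 0 < δ n) :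
    ∃ G : ℕ → ℝ → F, (∀ n, ContDiff ℝ ∞ (G n)) ∧ (∀ t, (fun n => G n t - g t) =o[atTop] δ) ∧
      (∀ n t, ‖deriv (G n) t‖ ≤ C) ∧
      ∀ᵐ t, Tendsto (fun n => deriv (G n) t) atTop (𝓝 (deriv g t)) := by
  obtain ⟨G, hG, hGg, hG'⟩ := exists_smooth_approx_of_lipschitz hg (ε := fun n => δ n ^ 2)
    (fun n => pow_pos (hδ0 n) 2) (by simpa using hδ.pow 2)
  refine ⟨G, hG, fun t => ?_, hG'⟩
  have hO : (fun n => G n t - g t) =O[atTop] fun n => δ n ^ 2 :=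
    Asymptotics.IsBigO.of_bound C (Eventually.of_forall fun n => by
      simpa only [norm_pow, sq_abs, Real.norm_eq_abs] using hGg n t)
  refine hO.trans_isLittleO ?_
  simpa only [pow_two, mul_one] using (Asymptotics.isBigO_refl δ atTop).mul_isLittleO
    ((Asymptotics.isLittleO_one_iff ℝ).2 hδ)

end Mollification

/-! ### Boundary layers -/

/-- A function of height `δ` and gradient of order one that varies across a layer of width `δ`
around the zero set of `h`, with profile `η` across the layer and amplitude `ψ` along it. -/
def boundaryLayer {E F : Type*} [SMul ℝ F] (η : ℝ → ℝ) (h : E → ℝ) (ψ : E → F) (δ : ℝ) (x : E) :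
    F :=
  (δ * η (h x / δ)) • ψ x

theorem exists_profile : ∃ η : ℝ → ℝ, ContDiff ℝ ∞ η ∧ HasCompactSupport η ∧ deriv η 0 = 1 := by
  let β : ContDiffBump (0 : ℝ) := ⟨1, 2, one_pos, one_lt_two⟩
  refine ⟨fun s => s * β s, contDiff_id.mul β.contDiff, β.hasCompactSupport.mul_left, ?_⟩
  have h : (fun s => s * β s) =ᶠ[𝓝 0] id := by
    filter_upwards [β.eventuallyEq_one] with s hs
    rw [hs, Pi.one_apply, mul_one, id]
  rw [h.deriv_eq, deriv_id]

section BoundaryLayer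

variable {E F : Type*} [NormedAddCommGroup E] [NormedSpace ℝ E] [NormedAddCommGroup F]
  [NormedSpace ℝ F] {η : ℝ → ℝ} {ψ : E → F} {x : E}

theorem hasFDerivAt_boundaryLayer {h : E → ℝ} {δ η' : ℝ} {h' : E →L[ℝ] ℝ} {ψ' : E →L[ℝ] F}
    (hη : HasDerivAt η η' (h x / δ)) (hh : HasFDerivAt h h' x) (hψ : HasFDerivAt ψ ψ' x)
    (hδ : δ ≠ 0) :
    HasFDerivAt (boundaryLayer η h ψ δ)
      ((δ * η (h x / δ)) • ψ' + (η' • h').smulRight (ψ x)) x := by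
  have hscaled : HasFDerivAt (fun x => h x / δ) (δ⁻¹ • h') x := by
    simpa only [div_eq_mul_inv] using hh.mul_const δ⁻¹
  have hprofile := (hη.comp_hasFDerivAt x hscaled).const_mul δ
  rw [smul_comm η', smul_inv_smul₀ hδ] at hprofile
  exact hprofile.smul hψ

theorem exists_bound_boundaryLayer (hη : ContDiff ℝ 1 η) (hηc : HasCompactSupport η)
    (hψ : ContDiff ℝ 1 ψ) (hψc : HasCompactSupport ψ) {L : ℝ} (hL : 0 ≤ L) :
    ∃ M, ∀ (h : E → ℝ) (h' : E →L[ℝ] ℝ) (x : E) (δ : ℝ), HasFDerivAt h h' x → ‖h'‖ ≤ L →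
      0 < δ → δ ≤ 1 → ‖boundaryLayer η h ψ δ x‖ ≤ M * δ ∧
        ‖fderiv ℝ (boundaryLayer η h ψ δ) x‖ ≤ M := by
  obtain ⟨M₀, hM₀⟩ := hηc.exists_bound_of_continuous hη.continuous
  obtain ⟨M₁, hM₁⟩ := hηc.deriv.exists_bound_of_continuous (hη.continuous_deriv le_rfl)
  obtain ⟨N₀, hN₀⟩ := hψc.exists_bound_of_continuous hψ.continuous
  obtain ⟨N₁, hN₁⟩ :=
    (hψc.fderiv (𝕜 := ℝ)).exists_bound_of_continuous (hψ.continuous_fderiv one_ne_zero)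
  have hM₀0 : 0 ≤ M₀ := (norm_nonneg _).trans (hM₀ 0)
  have hM₁0 : 0 ≤ M₁ := (norm_nonneg _).trans (hM₁ 0)
  refine ⟨max (M₀ * N₀) (M₀ * N₁ + M₁ * L * N₀), fun h h' x δ hh hh' hδ hδ1 => ⟨?_, ?_⟩⟩
  · calc ‖boundaryLayer η h ψ δ x‖ = ‖η (h x / δ)‖ * ‖ψ x‖ * δ := by
          rw [boundaryLayer, norm_smul, norm_mul, Real.norm_of_nonneg hδ.le]
          ring
      _ ≤ M₀ * N₀ * δ := by gcongr; exacts [hM₀ _, hN₀ x]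
      _ ≤ _ := by gcongr; exact le_max_left _ _
  · have hheight : ‖δ * η (h x / δ)‖ ≤ M₀ := by
      rw [norm_mul, Real.norm_of_nonneg hδ.le]
      exact (mul_le_of_le_one_left (norm_nonneg _) hδ1).trans (hM₀ _)
    rw [(hasFDerivAt_boundaryLayer (hη.differentiable one_ne_zero _).hasDerivAt hh
      (hψ.differentiable one_ne_zero x).hasFDerivAt hδ.ne').fderiv]
    refine ((norm_add_le _ _).trans ?_).trans (le_max_right _ _)
    rw [norm_smul, ContinuousLinearMap.norm_smulRight_apply, norm_smul]
    gcongr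
    exacts [hN₁ x, hM₁ _, hN₀ x]

theorem fderiv_boundaryLayer_of_notMem_tsupport (h : E → ℝ) (δ : ℝ) (hx : x ∉ tsupport ψ) :
    fderiv ℝ (boundaryLayer η h ψ δ) x = 0 := by
  have hzero : boundaryLayer η h ψ δ =ᶠ[𝓝 x] fun _ => 0 := by
    filter_upwards [notMem_tsupport_iff_eventuallyEq.1 hx] with y hy
    rw [boundaryLayer, hy, Pi.zero_apply, smul_zero]
  rw [hzero.fderiv_eq, fderiv_const_apply]

theorem tendsto_fderiv_boundaryLayer_of_ne_zero (hη : HasCompactSupport η) {h : ℕ → E → ℝ}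
    {δ : ℕ → ℝ} {c : ℝ} (hδ : Tendsto δ atTop (𝓝[>] 0)) (hcont : ∀ n, ContinuousAt (h n) x)
    (hc : c ≠ 0) (hlim : Tendsto (fun n => h n x) atTop (𝓝 c)) :
    Tendsto (fun n => fderiv ℝ (boundaryLayer η (h n) ψ (δ n)) x) atTop (𝓝 0) := by
  have hfar : Tendsto (fun n => h n x / δ n) atTop (cocompact ℝ) := by
    rw [← Metric.cobounded_eq_cocompact, ← tendsto_norm_atTop_iff_cobounded]
    refine (hlim.norm.pos_mul_atTop (norm_pos_iff.2 hc)
      (tendsto_norm_atTop_atTop.comp hδ.inv_tendsto_nhdsGT_zero)).congr fun n => ?_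
    rw [div_eq_mul_inv, norm_mul, Function.comp_apply, Pi.inv_apply]
  refine tendsto_const_nhds.congr' ?_
  filter_upwards [hfar hη.isCompact.compl_mem_cocompact] with n hn
  have hzero : boundaryLayer η (h n) ψ (δ n) =ᶠ[𝓝 x] fun _ => 0 := by
    filter_upwards [((hcont n).div_const (δ n)).eventually
      (notMem_tsupport_iff_eventuallyEq.1 hn)] with y hy
    rw [boundaryLayer, hy, Pi.zero_apply, mul_zero, zero_smul]
  rw [hzero.fderiv_eq, fderiv_const_apply]

theorem tendsto_fderiv_boundaryLayer_apply (hη : ContDiff ℝ 1 η) (hψ : DifferentiableAt ℝ ψ x)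
    {h : ℕ → E → ℝ} {h' : ℕ → E →L[ℝ] ℝ} {δ : ℕ → ℝ} {ν : E} {a : ℝ}
    (hδ : Tendsto δ atTop (𝓝[>] 0)) (hh : ∀ n, HasFDerivAt (h n) (h' n) x)
    (hnear : Tendsto (fun n => h n x / δ n) atTop (𝓝 0))
    (ha : Tendsto (fun n => h' n ν) atTop (𝓝 a)) :
    Tendsto (fun n => fderiv ℝ (boundaryLayer η (h n) ψ (δ n)) x ν) atTop
      (𝓝 ((deriv η 0 * a) • ψ x)) := by
  have hheight : Tendsto (fun n => δ n * η (h n x / δ n)) atTop (𝓝 0) := by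
    simpa using (hδ.mono_right nhdsWithin_le_nhds).mul ((hη.continuous.tendsto 0).comp hnear)
  have hslope : Tendsto (fun n => deriv η (h n x / δ n)) atTop (𝓝 (deriv η 0)) :=
    ((hη.continuous_deriv le_rfl).tendsto 0).comp hnear
  have hsum := (hheight.smul_const (fderiv ℝ ψ x ν)).add ((hslope.mul ha).smul_const (ψ x))
  rw [zero_smul, zero_add] at hsum
  refine hsum.congr' ?_
  filter_upwards [hδ self_mem_nhdsWithin] with n hn
  rw [(hasFDerivAt_boundaryLayer (hη.differentiable one_ne_zero _).hasDerivAt (hh n)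
    hψ.hasFDerivAt (ne_of_gt hn)).fderiv]
  rfl

end BoundaryLayer

theorem isTest_boundaryLayer {η : ℝ → ℝ} {h : Plane → ℝ} {ψ : Plane → ℂ} (hη : ContDiff ℝ ∞ η)
    (hh : ContDiff ℝ ∞ h) (hψ : IsTest ψ) (δ : ℝ) : IsTest (boundaryLayer η h ψ δ) :=
  ⟨(contDiff_const.mul (hη.comp (hh.div_const δ))).smul hψ.1,
    hψ.2.smul_left (f := fun x => δ * η (h x / δ))⟩

/-- Test functions that tend to zero boundedly together with their gradients in `U`, while their
normal derivatives on the boundary of `U` tend to `b`. Along such a sequence a boundary functional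
only sees the coefficient of the normal derivative. -/
structure IsNormalConcentration (U : Set Plane) (φ : ℕ → Plane → ℂ) (b : Plane → ℂ) : Prop where
  isTest : ∀ n, IsTest (φ n)
  exists_bound : ∃ M, ∀ n x, ‖φ n x‖ ≤ M ∧ ‖fderiv ℝ (φ n) x‖ ≤ M
  tendsto_zero : ∀ x, Tendsto (fun n => φ n x) atTop (𝓝 0)
  tendsto_fderiv_zero : ∀ x ∈ U, Tendsto (fun n => fderiv ℝ (φ n) x) atTop (𝓝 0)
  tendsto_normalDeriv : ∀ᵐ x ∂arcLength (frontier U),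
    Tendsto (fun n => fderiv ℝ (φ n) x (outwardNormal U x)) atTop (𝓝 (b x))

namespace IsGraphChart

variable {U V : Set Plane} {p : Plane} {R : Plane ≃ₗᵢ[ℝ] Plane} {g : ℝ → ℝ} {C : NNReal}
  {ψ : Plane → ℂ} {η : ℝ → ℝ} {G : ℕ → ℝ → ℝ} {δ : ℕ → ℝ}

theorem tendsto_fderiv_boundaryLayer_zero (h : IsGraphChart U V p R g C) (hψV : tsupport ψ ⊆ V)
    (hη : HasCompactSupport η) (hG : ∀ n, Continuous (G n))
    (hGg : ∀ t, Tendsto (fun n => G n t) atTop (𝓝 (g t))) (hδ : Tendsto δ atTop (𝓝[>] 0))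
    {x : Plane} (hx : x ∈ U) :
    Tendsto (fun n => fderiv ℝ (boundaryLayer η (graphHeight p R (G n)) ψ (δ n)) x) atTop
      (𝓝 0) := by
  by_cases hxV : x ∈ V
  · exact tendsto_fderiv_boundaryLayer_of_ne_zero hη hδ
      (fun n => (continuous_graphHeight (hG n)).continuousAt) ((h.mem_iff x hxV).1 hx).ne
      (tendsto_const_nhds.sub (hGg _))
  · simp only [fderiv_boundaryLayer_of_notMem_tsupport _ _ fun hm => hxV (hψV hm)]
    exact tendsto_const_nhds

theorem ae_tendsto_fderiv_boundaryLayer_outwardNormal (h : IsGraphChart U V p R g C)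
    (hU : IsOpen U) (hψ : IsTest ψ) (hψV : tsupport ψ ⊆ V) (hη : ContDiff ℝ 1 η)
    (hη1 : deriv η 0 = 1) (hG : ∀ n, Differentiable ℝ (G n))
    (hGg : ∀ t, Tendsto (fun n => (G n t - g t) / δ n) atTop (𝓝 0))
    (hG' : ∀ᵐ t, Tendsto (fun n => deriv (G n) t) atTop (𝓝 (deriv g t)))
    (hδ : Tendsto δ atTop (𝓝[>] 0)) :
    ∀ᵐ x ∂arcLength (frontier U), Tendsto (fun n =>
      fderiv ℝ (boundaryLayer η (graphHeight p R (G n)) ψ (δ n)) x (outwardNormal U x)) atTop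
        (𝓝 (slopeNorm (deriv g (rotCoord R 0 (x - p))) • ψ x)) := by
  have hmeas : MeasurableSet (frontier U) := isClosed_frontier.measurableSet
  have hmeasV := h.isOpen.measurableSet.inter hmeas
  rw [arcLength, ae_restrict_iff' hmeas]
  filter_upwards [(ae_restrict_iff' hmeasV).1 (h.ae_outwardNormal_eq hU),
    (ae_restrict_iff' hmeasV).1 (h.ae_of_ae_abscissa hU hG')] with x hνx hG'x hxU
  by_cases hxV : x ∈ V
  · rw [hνx ⟨hxV, hxU⟩]
    have hon : rotCoord R 1 (x - p) = g (rotCoord R 0 (x - p)) :=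
      sub_eq_zero.1 ((h.mem_frontier_iff hU hxV).1 hxU)
    have hnear : Tendsto (fun n => graphHeight p R (G n) x / δ n) atTop (𝓝 0) := by
      simpa only [graphHeight, hon, ← neg_sub (G _ _) (g _), neg_div, neg_zero]
        using (hGg (rotCoord R 0 (x - p))).neg
    have hconormal : Tendsto (fun s => graphConormal R s
        (graphNormal R (deriv g (rotCoord R 0 (x - p))))) (𝓝 (deriv g (rotCoord R 0 (x - p))))
        (𝓝 (slopeNorm (deriv g (rotCoord R 0 (x - p))))) := by
      rw [← graphConormal_graphNormal R]
      exact Continuous.tendsto (by unfold graphConormal; fun_prop) _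
    simpa only [hη1, one_mul] using tendsto_fderiv_boundaryLayer_apply hη
      (hψ.1.differentiable (by simp) x) hδ
      (fun n => hasFDerivAt_graphHeight (hG n _).hasDerivAt) hnear
      (hconormal.comp (hG'x ⟨hxV, hxU⟩))
  · have hxψ : x ∉ tsupport ψ := fun hm => hxV (hψV hm)
    simp only [fderiv_boundaryLayer_of_notMem_tsupport _ _ hxψ, zero_apply,
      image_eq_zero_of_notMem_tsupport hxψ, smul_zero]
    exact tendsto_const_nhds

theorem exists_isNormalConcentration (h : IsGraphChart U V p R g C) (hU : IsOpen U)
    (hψ : IsTest ψ) (hψV : tsupport ψ ⊆ V) :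
    ∃ φ, IsNormalConcentration U φ
      fun x => slopeNorm (deriv g (rotCoord R 0 (x - p))) • ψ x := by
  obtain ⟨η, hη, hηc, hη1⟩ := exists_profile
  let δ (n : ℕ) : ℝ := 1 / ((n : ℝ) + 1)
  have hδ0 (n : ℕ) : 0 < δ n := Nat.one_div_pos_of_nat
  have hδ1 (n : ℕ) : δ n ≤ 1 := by simpa [δ] using Nat.one_div_le_one_div (α := ℝ) n.zero_le
  have hδt : Tendsto δ atTop (𝓝 0) := tendsto_one_div_add_atTop_nhds_zero_nat
  have hδ : Tendsto δ atTop (𝓝[>] 0) :=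
    tendsto_nhdsWithin_iff.2 ⟨hδt, Eventually.of_forall hδ0⟩
  obtain ⟨G, hG, hGg, hG', hGt⟩ :=
    exists_smooth_approx_isLittleO_of_lipschitz h.lipschitz hδt hδ0
  have hGd (n : ℕ) : Differentiable ℝ (G n) := (hG n).differentiable (by simp)
  have hGlim (t : ℝ) : Tendsto (fun n => G n t) atTop (𝓝 (g t)) :=
    tendsto_sub_nhds_zero_iff.1 ((hGg t).trans_tendsto hδt)
  obtain ⟨M, hM⟩ := exists_bound_boundaryLayer (hη.of_le (by simp)) hηc (hψ.1.of_le (by simp))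
    hψ.2 (show (0 : ℝ) ≤ 1 + C by positivity)
  have hbound (n : ℕ) (x : Plane) := hM (graphHeight p R (G n)) _ x (δ n)
    (hasFDerivAt_graphHeight (hGd n _).hasDerivAt)
    ((norm_graphConormal_le R _).trans (by gcongr; exact hG' n _)) (hδ0 n) (hδ1 n)
  have hM0 : 0 ≤ M := (norm_nonneg _).trans (hbound 0 0).2
  refine ⟨fun n => boundaryLayer η (graphHeight p R (G n)) ψ (δ n),
    fun n => isTest_boundaryLayer hη (contDiff_graphHeight (hG n)) hψ (δ n),
    ⟨M, fun n x => ⟨(hbound n x).1.trans (mul_le_of_le_one_right hM0 (hδ1 n)), (hbound n x).2⟩⟩,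
    fun x => ?_, fun x hx => ?_, ?_⟩
  · exact squeeze_zero_norm (fun n => (hbound n x).1) (by simpa using hδt.const_mul M)
  · exact h.tendsto_fderiv_boundaryLayer_zero hψV hηc (fun n => (hG n).continuous) hGlim hδ hx
  · exact h.ae_tendsto_fderiv_boundaryLayer_outwardNormal hU hψ hψV (hη.of_le (by simp)) hη1 hGd
      (fun t => (hGg t).tendsto_div_nhds_zero) hGt hδ

end IsGraphChart

/-! ### The Green form -/

/-- The defect in Green's formula on `U` for a weak gradient `G`, Laplacian `F` and normal
derivative `D`, with an additional boundary term in which `B` is paired with the normal derivative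
of the test function. -/
def greenForm (U : Set Plane) (G : Fin 2 → Plane → ℂ) (F D B φ : Plane → ℂ) : ℂ :=
  (∫ x in U, ∑ i, G i x * pderiv i φ x) + (∫ x in U, F x * φ x)
    - (∫ x, D x * φ x ∂arcLength (frontier U))
    - ∫ x, B x * fderiv ℝ φ x (outwardNormal U x) ∂arcLength (frontier U)

theorem norm_pderiv_le (i : Fin 2) (φ : Plane → ℂ) (x : Plane) :
    ‖pderiv i φ x‖ ≤ ‖fderiv ℝ φ x‖ :=
  (ContinuousLinearMap.le_opNorm _ _).trans_eq (by simp)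

theorem continuous_pderiv {φ : Plane → ℂ} (hφ : ContDiff ℝ ∞ φ) (i : Fin 2) :
    Continuous (pderiv i φ) :=
  (hφ.continuous_fderiv (by simp)).clm_apply continuous_const

theorem IsTest.const_mul {φ : Plane → ℂ} (hφ : IsTest φ) (c : ℂ) : IsTest fun x => c * φ x :=
  ⟨contDiff_const.mul hφ.1, hφ.2.mul_left (f := fun _ => c)⟩

section GreenForm

variable {U : Set Plane} {G : Fin 2 → Plane → ℂ} {F D B : Plane → ℂ}

theorem greenForm_const_mul (c : ℂ) {φ : Plane → ℂ} (hφ : Differentiable ℝ φ) :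
    greenForm U G F D B (fun x => c * φ x) = c * greenForm U G F D B φ := by
  have hfderiv (x y : Plane) : fderiv ℝ (fun x => c * φ x) x y = c * fderiv ℝ φ x y := by
    rw [fderiv_const_mul (hφ x), smul_apply, smul_eq_mul]
  simp only [greenForm, pderiv, hfderiv, mul_left_comm _ c, ← Finset.mul_sum, integral_const_mul]
  ring

theorem forall_re_greenForm_eq_zero_iff :
    (∀ φ, IsTest φ → (greenForm U G F D B φ).re = 0) ↔
      ∀ φ, IsTest φ → greenForm U G F D B φ = 0 := by
  refine ⟨fun h φ hφ => Complex.ext (h φ hφ) ?_, fun h φ hφ => by rw [h φ hφ, Complex.zero_re]⟩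
  have := h _ (hφ.const_mul Complex.I)
  rwa [greenForm_const_mul _ (hφ.1.differentiable (by simp)), Complex.I_mul_re,
    neg_eq_zero] at this

theorem greenForm_of_ae_eq_zero (hB : ∀ᵐ x ∂arcLength (frontier U), B x = 0) (φ : Plane → ℂ) :
    greenForm U G F D B φ = (∫ x in U, ∑ i, G i x * pderiv i φ x) + (∫ x in U, F x * φ x)
      - ∫ x, D x * φ x ∂arcLength (frontier U) := by
  have hzero : ∫ x, B x * fderiv ℝ φ x (outwardNormal U x) ∂arcLength (frontier U) = 0 :=
    integral_eq_zero_of_ae (hB.mono fun _ hx => mul_eq_zero_of_left hx _)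
  rw [greenForm, hzero, sub_zero]

end GreenForm

theorem tendsto_integral_mul_of_bounded {X : Type*} [MeasurableSpace X] {μ : Measure X}
    {a : ℕ → X → ℂ} {b f : X → ℂ} {M : ℝ} (hf : Integrable f μ)
    (ha : ∀ n, AEStronglyMeasurable (a n) μ) (hM : ∀ n x, ‖a n x‖ ≤ M)
    (hlim : ∀ᵐ x ∂μ, Tendsto (fun n => a n x) atTop (𝓝 (b x))) :
    Tendsto (fun n => ∫ x, f x * a n x ∂μ) atTop (𝓝 (∫ x, f x * b x ∂μ)) := by
  refine tendsto_integral_of_dominated_convergence (fun x => ‖f x‖ * M)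
    (fun n => hf.1.mul (ha n)) (hf.norm.mul_const M) (fun n => Eventually.of_forall fun x => ?_)
    (hlim.mono fun x hx => hx.const_mul _)
  rw [norm_mul]
  exact mul_le_mul_of_nonneg_left (hM n x) (norm_nonneg _)

namespace IsLipschitzDomain

variable {U : Set Plane} {G : Fin 2 → Plane → ℂ} {F D B : Plane → ℂ}

theorem tendsto_greenForm (hU : IsLipschitzDomain U)
    (hG : ∀ i, Integrable (G i) (volume.restrict U)) (hF : Integrable F (volume.restrict U))
    (hD : Integrable D (arcLength (frontier U))) (hB : Integrable B (arcLength (frontier U)))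
    {φ : ℕ → Plane → ℂ} {b : Plane → ℂ} (hφ : IsNormalConcentration U φ b) :
    Tendsto (fun n => greenForm U G F D B (φ n)) atTop
      (𝓝 (-∫ x, B x * b x ∂arcLength (frontier U))) := by
  obtain ⟨M, hM⟩ := hφ.exists_bound
  have hmeas (n : ℕ) (μ : Measure Plane) : AEStronglyMeasurable (φ n) μ :=
    (hφ.isTest n).1.continuous.aestronglyMeasurable
  have hgrad : Tendsto (fun n => ∫ x in U, ∑ i, G i x * pderiv i (φ n) x) atTop (𝓝 0) := by
    have hmeas' (n : ℕ) (i : Fin 2) :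
        AEStronglyMeasurable (pderiv i (φ n)) (volume.restrict U) :=
      (continuous_pderiv (hφ.isTest n).1 i).aestronglyMeasurable
    have hM' (n : ℕ) (i : Fin 2) (x : Plane) : ‖pderiv i (φ n) x‖ ≤ M :=
      (norm_pderiv_le i _ x).trans (hM n x).2
    have hint (n : ℕ) (i : Fin 2) :
        Integrable (fun x => G i x * pderiv i (φ n) x) (volume.restrict U) :=
      (hG i).mul_bdd (hmeas' n i) (Eventually.of_forall (hM' n i))
    have hlim (i : Fin 2) : ∀ᵐ x ∂volume.restrict U,
        Tendsto (fun n => pderiv i (φ n) x) atTop (𝓝 0) := by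
      filter_upwards [ae_restrict_mem hU.isOpen.measurableSet] with x hx
      exact squeeze_zero_norm (fun n => norm_pderiv_le i _ x)
        (by simpa using (hφ.tendsto_fderiv_zero x hx).norm)
    simp only [integral_finsetSum _ fun i _ => hint _ i]
    simpa using tendsto_finsetSum Finset.univ fun i _ => tendsto_integral_mul_of_bounded (hG i)
      (fun n => hmeas' n i) (fun n => hM' n i) (hlim i)
  have hfun := tendsto_integral_mul_of_bounded hF (fun n => hmeas n _) (fun n x => (hM n x).1)
    (Eventually.of_forall hφ.tendsto_zero)
  have htrace := tendsto_integral_mul_of_bounded hD (fun n => hmeas n _) (fun n x => (hM n x).1)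
    (Eventually.of_forall hφ.tendsto_zero)
  have hnormal := tendsto_integral_mul_of_bounded hB
    (fun n => hU.aestronglyMeasurable_fderiv_outwardNormal (hφ.isTest n).1)
    (fun n x => (norm_fderiv_outwardNormal_le U _ x).trans (hM n x).2) hφ.tendsto_normalDeriv
  simpa [greenForm] using ((hgrad.add hfun).sub htrace).sub hnormal

theorem ae_eq_zero_of_forall_greenForm_eq_zero (hU : IsLipschitzDomain U)
    (hG : ∀ i, Integrable (G i) (volume.restrict U)) (hF : Integrable F (volume.restrict U))
    (hD : Integrable D (arcLength (frontier U))) (hB : Integrable B (arcLength (frontier U)))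
    (h : ∀ φ, IsTest φ → greenForm U G F D B φ = 0) :
    ∀ᵐ x ∂arcLength (frontier U), B x = 0 := by
  refine hU.frontier_induction (P := fun s => ∀ᵐ x ∂arcLength s, B x = 0) ?_
    (fun s t hst ht => ae_restrict_of_ae_restrict_of_subset hst ht)
    (fun s t hs ht => (ae_restrict_union_iff s t _).2 ⟨hs, ht⟩) fun V p R g C hchart => ?_
  · simp only [arcLength, Measure.restrict_empty, ae_zero, eventually_bot]
  let m (x : Plane) : ℝ := slopeNorm (deriv g (rotCoord R 0 (x - p)))
  have hm : Measurable m := measurable_slopeNorm.comp ((measurable_deriv g).comp (by fun_prop))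
  have hmC (x : Plane) : ‖m x‖ ≤ slopeNorm C := by
    rw [Real.norm_of_nonneg (slopeNorm_pos _).le]
    refine slopeNorm_le_slopeNorm ?_
    rw [abs_of_nonneg C.coe_nonneg]
    exact norm_deriv_le_of_lipschitz hchart.lipschitz
  have hmB : Integrable (fun x => m x • B x) (arcLength (frontier U)) :=
    hB.bdd_smul (slopeNorm C) hm.aestronglyMeasurable (Eventually.of_forall hmC)
  have horth (ψ : Plane → ℝ) (hψ : ContDiff ℝ ∞ ψ) (hψc : HasCompactSupport ψ)
      (hψV : tsupport ψ ⊆ V) : ∫ x, ψ x • (m x • B x) ∂arcLength (frontier U) = 0 := by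
    have hψ' : IsTest fun x => (ψ x : ℂ) :=
      ⟨Complex.ofRealCLM.contDiff.comp hψ, hψc.comp_left Complex.ofReal_zero⟩
    have hψV' : tsupport (fun x => (ψ x : ℂ)) ⊆ V :=
      (tsupport_comp_subset Complex.ofReal_zero ψ).trans hψV
    obtain ⟨φ, hφ⟩ := hchart.exists_isNormalConcentration hU.isOpen hψ' hψV'
    have hlim := hU.tendsto_greenForm hG hF hD hB hφ
    simp only [h _ (hφ.isTest _)] at hlim
    rw [← neg_eq_zero.1 (tendsto_nhds_unique hlim tendsto_const_nhds)]
    refine integral_congr_ae (Eventually.of_forall fun x => ?_)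
    simp only [m, Complex.real_smul]
    ring
  have hzero := hchart.isOpen.ae_eq_zero_of_integral_contDiff_smul_eq_zero
    (hmB.locallyIntegrable.locallyIntegrableOn V) horth
  have hmeas : MeasurableSet (frontier U) := isClosed_frontier.measurableSet
  rw [arcLength, ae_restrict_iff' hmeas] at hzero
  rw [arcLength, ae_restrict_iff' (hchart.isOpen.measurableSet.inter hmeas)]
  filter_upwards [hzero] with x hx hxV
  exact (smul_eq_zero.1 (hx hxV.2 hxV.1)).resolve_left (slopeNorm_pos _).ne'

theorem forall_greenForm_eq_zero_iff (hU : IsLipschitzDomain U)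
    (hG : ∀ i, MemLp (G i) 2 (volume.restrict U)) (hF : MemLp F 2 (volume.restrict U))
    (hD : MemLp D 2 (arcLength (frontier U))) (hB : MemLp B 2 (arcLength (frontier U))) :
    (∀ φ, IsTest φ → greenForm U G F D B φ = 0) ↔
      (∀ᵐ x ∂arcLength (frontier U), B x = 0) ∧ IsNormalDeriv U (frontier U) G F D := by
  have := hU.isFiniteMeasure_arcLength_frontier
  have := hU.isFiniteMeasure_volume_restrict
  refine ⟨fun h => ?_, fun ⟨hB0, h⟩ φ hφ => ?_⟩
  · have hB0 := hU.ae_eq_zero_of_forall_greenForm_eq_zero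
      (fun i => (hG i).integrable one_le_two) (hF.integrable one_le_two)
      (hD.integrable one_le_two) (hB.integrable one_le_two) h
    refine ⟨hB0, hD, fun φ hφ => sub_eq_zero.1 ?_⟩
    rw [← greenForm_of_ae_eq_zero hB0, h φ hφ]
  · rw [greenForm_of_ae_eq_zero hB0, h.2 φ hφ, sub_self]

end IsLipschitzDomain

theorem IsNormalDeriv.isWeakLaplacian {U : Set Plane} {G : Fin 2 → Plane → ℂ} {F D : Plane → ℂ}
    (h : IsNormalDeriv U (frontier U) G F D) (hU : IsOpen U) (hF : MemLp F 2 (volume.restrict U)) :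
    IsWeakLaplacian U G F := by
  refine ⟨hF, fun φ hφ hφU => eq_neg_of_add_eq_zero_left ((h.2 φ hφ).trans ?_)⟩
  refine integral_eq_zero_of_ae ((ae_restrict_mem isClosed_frontier.measurableSet).mono ?_)
  intro x hx
  have hxφ : x ∉ tsupport φ := fun hm => (hU.frontier_eq ▸ hx).2 (hφU hm)
  exact mul_eq_zero_of_right _ (image_eq_zero_of_notMem_tsupport hxφ)

/-! ### The Lipschitz domain of a configuration -/

namespace IsLipschitzDomain

variable {U : Set Plane} {p : ℝ≥0∞}

theorem memLp_of_continuous (hU : IsLipschitzDomain U) {f : Plane → ℂ} (hf : Continuous f) :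
    MemLp f p (volume.restrict U) := by
  have := hU.isFiniteMeasure_volume_restrict
  obtain ⟨M, hM⟩ := hU.isBounded.isCompact_closure.exists_bound_of_continuousOn hf.continuousOn
  refine MemLp.of_bound hf.aestronglyMeasurable M ?_
  filter_upwards [ae_restrict_mem hU.isOpen.measurableSet] with x hx
  exact hM x (subset_closure hx)

theorem memLp_arcLength_of_continuous (hU : IsLipschitzDomain U) {f : Plane → ℂ}
    (hf : Continuous f) : MemLp f p (arcLength (frontier U)) := by
  have := hU.isFiniteMeasure_arcLength_frontier
  obtain ⟨M, hM⟩ := hU.isBounded.isCompact_closure.exists_bound_of_continuousOn hf.continuousOn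
  refine MemLp.of_bound hf.aestronglyMeasurable M ?_
  filter_upwards [ae_restrict_mem isClosed_frontier.measurableSet] with x hx
  exact hM x (frontier_subset_closure hx)

theorem memLp_fderiv_outwardNormal (hU : IsLipschitzDomain U) {φ : Plane → ℂ}
    (hφ : ContDiff ℝ ∞ φ) :
    MemLp (fun x => fderiv ℝ φ x (outwardNormal U x)) p (arcLength (frontier U)) := by
  have := hU.isFiniteMeasure_arcLength_frontier
  obtain ⟨M, hM⟩ := hU.isBounded.isCompact_closure.exists_bound_of_continuousOn
    (hφ.continuous_fderiv (by simp)).continuousOn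
  refine MemLp.of_bound (hU.aestronglyMeasurable_fderiv_outwardNormal hφ) M ?_
  filter_upwards [ae_restrict_mem isClosed_frontier.measurableSet] with x hx
  exact (norm_fderiv_outwardNormal_le U φ x).trans (hM x (frontier_subset_closure hx))

end IsLipschitzDomain

theorem memLp_arcLength_mono {A B : Set Plane} (h : A ⊆ B) {p : ℝ≥0∞} {f : Plane → ℂ}
    (hf : MemLp f p (arcLength B)) : MemLp f p (arcLength A) :=
  hf.mono_measure (arcLength_mono h)

theorem arcLength_restrict {A B : Set Plane} (hA : MeasurableSet A) (h : A ⊆ B) :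
    (arcLength B).restrict A = arcLength A := by
  rw [arcLength, Measure.restrict_restrict hA, Set.inter_eq_left.2 h, arcLength]

theorem memLp_arcLength_indicator {A B : Set Plane} (hA : MeasurableSet A) (h : A ⊆ B)
    {p : ℝ≥0∞} {f : Plane → ℂ} (hf : MemLp f p (arcLength A)) :
    MemLp (A.indicator f) p (arcLength B) := by
  rwa [memLp_indicator_iff_restrict hA, arcLength_restrict hA h]

namespace Configuration

variable (S : Configuration)

theorem frontier_tank_subset : frontier S.tank ⊆ (closure S.obstacle)ᶜ := fun _ hx hxD =>
  (S.isOpen_tank.frontier_eq ▸ hx).2 (S.closure_obstacle_subset hxD)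

theorem frontier_compl_closure_obstacle : frontier (closure S.obstacle)ᶜ = S.Γ₅ :=
  S.lipschitz_obstacle.frontier_compl_closure S.isOpen_obstacle

theorem frontier_compl_closure_obstacle_subset : frontier (closure S.obstacle)ᶜ ⊆ S.tank := by
  rw [frontier_compl_closure_obstacle]
  exact frontier_subset_closure.trans S.closure_obstacle_subset

theorem Γ_eq_frontier_Ω : S.Γ = frontier S.Ω := by
  rw [Γ, S.union_eq, Ω, Set.sdiff_eq, frontier_inter_eq_union S.isOpen_tank
    isClosed_closure.isOpen_compl S.frontier_tank_subset S.frontier_compl_closure_obstacle_subset,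
    frontier_compl_closure_obstacle]

theorem isLipschitzDomain_Ω : IsLipschitzDomain S.Ω where
  isOpen := S.isOpen_tank.sdiff isClosed_closure
  isBounded := S.isBounded_tank.subset Set.sdiff_subset
  lipschitz := S.lipschitz_tank.inter S.lipschitz_obstacle.compl_closure S.isOpen_tank
    isClosed_closure.isOpen_compl S.frontier_tank_subset S.frontier_compl_closure_obstacle_subset

theorem Γ₁_subset : S.Γ₁ ⊆ S.Γ := fun _ h => Or.inl (Or.inl (Or.inl (Or.inl h)))

theorem Γ₂_subset : S.Γ₂ ⊆ S.Γ := fun _ h => Or.inl (Or.inl (Or.inl (Or.inr h)))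

theorem Γ₃_subset : S.Γ₃ ⊆ S.Γ := fun _ h => Or.inl (Or.inl (Or.inr h))

theorem Γ₄_subset : S.Γ₄ ⊆ S.Γ := fun _ h => Or.inl (Or.inr h)

theorem Γ₁_union_Γ₅_subset : S.Γ₁ ∪ S.Γ₅ ⊆ S.Γ :=
  Set.union_subset S.Γ₁_subset Set.subset_union_right

theorem measurable₅ : MeasurableSet S.Γ₅ := isClosed_frontier.measurableSet

theorem measurable₁₅ : MeasurableSet (S.Γ₁ ∪ S.Γ₅) := S.measurable₁.union S.measurable₅

theorem memLp_Γ_of_continuous {p : ℝ≥0∞} {f : Plane → ℂ} (hf : Continuous f) :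
    MemLp f p (arcLength S.Γ) :=
  S.Γ_eq_frontier_Ω ▸ S.isLipschitzDomain_Ω.memLp_arcLength_of_continuous hf

theorem memLp_dn {p : ℝ≥0∞} {φ : Plane → ℂ} (hφ : ContDiff ℝ ∞ φ) :
    MemLp (S.dn φ) p (arcLength S.Γ) :=
  S.Γ_eq_frontier_Ω ▸ S.isLipschitzDomain_Ω.memLp_fderiv_outwardNormal hφ

end Configuration

/-! ### The real pairing -/

section InnerRe

variable {μ : Measure Plane} {f f' g : Plane → ℂ}

theorem innerRe_comm (μ : Measure Plane) (f g : Plane → ℂ) : innerRe μ f g = innerRe μ g f := by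
  rw [innerRe, ← Complex.conj_re, ← integral_conj]
  simp only [map_mul, Complex.conj_conj, mul_comm, innerRe]

theorem integrable_mul_conj (hf : MemLp f 2 μ) (hg : MemLp g 2 μ) :
    Integrable (fun x => f x * conj (g x)) μ :=
  hf.integrable_mul hg.star

theorem innerRe_add_left (hf : MemLp f 2 μ) (hf' : MemLp f' 2 μ) (hg : MemLp g 2 μ) :
    innerRe μ (f + f') g = innerRe μ f g + innerRe μ f' g := by
  simp only [innerRe, Pi.add_apply, add_mul]
  rw [integral_add (integrable_mul_conj hf hg) (integrable_mul_conj hf' hg), Complex.add_re]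

theorem innerRe_sub_left (hf : MemLp f 2 μ) (hf' : MemLp f' 2 μ) (hg : MemLp g 2 μ) :
    innerRe μ (f - f') g = innerRe μ f g - innerRe μ f' g := by
  simp only [innerRe, Pi.sub_apply, sub_mul]
  rw [integral_sub (integrable_mul_conj hf hg) (integrable_mul_conj hf' hg), Complex.sub_re]

theorem innerRe_add_right (hf : MemLp f 2 μ) (hf' : MemLp f' 2 μ) (hg : MemLp g 2 μ) :
    innerRe μ g (f + f') = innerRe μ g f + innerRe μ g f' := by
  simp only [innerRe_comm μ g, innerRe_add_left hf hf' hg]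

theorem innerRe_smul_left (c : ℂ) (μ : Measure Plane) (f g : Plane → ℂ) :
    innerRe μ (c • f) g = innerRe μ f (conj c • g) := by
  simp only [innerRe, Pi.smul_apply, smul_eq_mul, map_mul, Complex.conj_conj, mul_left_comm,
    mul_assoc]

theorem innerRe_ofReal_smul_left (r : ℝ) (μ : Measure Plane) (f g : Plane → ℂ) :
    innerRe μ ((r : ℂ) • f) g = r * innerRe μ f g := by
  simp only [innerRe, Pi.smul_apply, smul_eq_mul, mul_assoc, integral_const_mul,
    Complex.re_ofReal_mul]

theorem innerRe_arcLength_indicator {A B : Set Plane} (hA : MeasurableSet A) (hAB : A ⊆ B)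
    (f g : Plane → ℂ) :
    innerRe (arcLength B) (A.indicator f) g = innerRe (arcLength A) f g := by
  have hmul (x : Plane) :
      A.indicator f x * conj (g x) = A.indicator (fun x => f x * conj (g x)) x :=
    (Set.indicator_mul_left A f fun x => conj (g x)).symm
  simp only [innerRe, hmul]
  rw [integral_indicator hA, arcLength_restrict hA hAB]

theorem hasDerivAt_innerRe (hf : MemLp f 2 μ) (hf' : MemLp f' 2 μ) (hg : MemLp g 2 μ) :
    HasDerivAt (fun ε : ℝ => innerRe μ (f + (ε : ℂ) • f') g) (innerRe μ f' g) 0 := by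
  simp only [fun ε : ℝ => innerRe_add_left hf (hf'.const_smul (ε : ℂ)) hg,
    innerRe_ofReal_smul_left]
  exact (hasDerivAt_mul_const (innerRe μ f' g)).const_add _

theorem hasDerivAt_innerRe_self (hf : MemLp f 2 μ) (hf' : MemLp f' 2 μ) :
    HasDerivAt (fun ε : ℝ => innerRe μ (f + (ε : ℂ) • f') (f + (ε : ℂ) • f'))
      (2 * innerRe μ f' f) 0 := by
  have hexpand (ε : ℝ) : innerRe μ (f + (ε : ℂ) • f') (f + (ε : ℂ) • f') =
      innerRe μ f f + ε * (2 * innerRe μ f' f) + ε ^ 2 * innerRe μ f' f' := by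
    have hεf' := hf'.const_smul (ε : ℂ)
    rw [innerRe_add_left hf hεf' (hf.add hεf'), innerRe_add_right hf hεf' hf,
      innerRe_add_right hf hεf' hεf', innerRe_comm μ f ((ε : ℂ) • f')]
    simp only [innerRe_ofReal_smul_left, innerRe_comm μ f' ((ε : ℂ) • f')]
    ring
  simp only [hexpand]
  simpa using ((hasDerivAt_mul_const (2 * innerRe μ f' f)).const_add (innerRe μ f f)).fun_add
    ((hasDerivAt_pow 2 (0 : ℝ)).mul_const (innerRe μ f' f'))

end InnerRe

/-! ### The derivative of the Lagrangian -/

theorem isTest_conj {φ : Plane → ℂ} (hφ : IsTest φ) : IsTest fun x => conj (φ x) :=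
  ⟨Complex.conjCLE.contDiff.comp hφ.1, hφ.2.comp_left (map_zero _)⟩

theorem fderiv_conj_apply {φ : Plane → ℂ} (hφ : Differentiable ℝ φ) (x y : Plane) :
    fderiv ℝ (fun x => conj (φ x)) x y = conj (fderiv ℝ φ x y) :=
  DFunLike.congr_fun
    (Complex.conjCLE.toContinuousLinearMap.hasFDerivAt.comp x (hφ x).hasFDerivAt).fderiv y

theorem IsLipschitzDomain.re_greenForm_conj {U : Set Plane} {G : Fin 2 → Plane → ℂ}
    {F D B φ : Plane → ℂ} (hU : IsLipschitzDomain U)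
    (hG : ∀ i, MemLp (G i) 2 (volume.restrict U)) (hφ : ContDiff ℝ ∞ φ) :
    (greenForm U G F D B fun x => conj (φ x)).re =
      ∑ i, innerRe (volume.restrict U) (G i) (pderiv i φ) + innerRe (volume.restrict U) F φ
        - innerRe (arcLength (frontier U)) D φ
        - innerRe (arcLength (frontier U)) B fun x => fderiv ℝ φ x (outwardNormal U x) := by
  have hint (i : Fin 2) (_ : i ∈ Finset.univ) :
      Integrable (fun x => G i x * conj (pderiv i φ x)) (volume.restrict U) :=
    integrable_mul_conj (hG i) (hU.memLp_of_continuous (continuous_pderiv hφ i))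
  have hconj := fderiv_conj_apply (hφ.differentiable (by simp))
  have hpderiv (i : Fin 2) (x : Plane) :
      pderiv i (fun x => conj (φ x)) x = conj (pderiv i φ x) := hconj x _
  simp only [greenForm, hpderiv, hconj]
  rw [integral_finsetSum _ hint, Complex.sub_re, Complex.sub_re, Complex.add_re, Complex.re_sum]
  rfl

theorem contDiff_incoming (k A θ : ℝ) : ContDiff ℝ ∞ (incoming k A θ) := by
  have hphase : ContDiff ℝ ∞ fun x : Plane => x 0 * Real.cos θ + x 1 * Real.sin θ := by fun_prop
  exact contDiff_const.mul (contDiff_const.mul (Complex.ofRealCLM.contDiff.comp hphase)).cexp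

theorem conj_alpha (K : ℝ) : conj (alpha K) = -alpha K := by
  apply Complex.ext <;> simp [alpha]

/-- The derivative at `u` of the Lagrangian in the direction of a smooth `φ`. -/
def lagrangianDeriv (S : Configuration) (k K : ℝ) (u₀ : Plane → ℂ) (u : CauchyField)
    (v : TracedField) (v₁ v₂ v₃ φ : Plane → ℂ) : ℝ :=
  innerRe (arcLength S.Γ₁) φ (u.trace - u₀)
    + ∑ i, innerRe (volume.restrict S.Ω) (pderiv i φ) (v.grad i)
    - k ^ 2 * innerRe (volume.restrict S.Ω) φ v.fn
    - innerRe (arcLength S.Γ) (S.dn φ) v.trace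
    - innerRe (arcLength (S.Γ₁ ∪ S.Γ₅)) (S.dn φ + (k * alpha K) • φ) v₁
    + innerRe (arcLength S.Γ₂) φ v₂
    + innerRe (arcLength S.Γ₃) φ v₂
    - innerRe (arcLength S.Γ₄) (S.dn φ + (-(Complex.I * k)) • φ) v₃

/-- The boundary function that is paired with the normal derivative of the variation of the state
in the derivative of the Lagrangian. -/
def normalCoeff (S : Configuration) (v : TracedField) (v₁ v₃ : Plane → ℂ) : Plane → ℂ :=
  v.trace + (S.Γ₁ ∪ S.Γ₅).indicator v₁ + S.Γ₄.indicator v₃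

/-- The boundary function that, up to sign, is paired with the boundary values of the variation of
the state in the derivative of the Lagrangian. The sign is such that this is the normal derivative
of an adjoint. -/
def traceCoeff (S : Configuration) (k K : ℝ) (u₀ : Plane → ℂ) (u : CauchyField)
    (v₁ v₂ v₃ : Plane → ℂ) : Plane → ℂ :=
  (-(k * alpha K)) • (S.Γ₁ ∪ S.Γ₅).indicator v₁ + (Complex.I * k) • S.Γ₄.indicator v₃
    - S.Γ₁.indicator (u.trace - u₀) - S.Γ₂.indicator v₂ - S.Γ₃.indicator v₂

section Lagrangian

variable {S : Configuration} {k A θ K : ℝ} {u₀ : Plane → ℂ} {u : CauchyField} {v : TracedField}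
  {v₁ v₂ v₃ φ : Plane → ℂ}

theorem hasDerivAt_objective (hu₀ : MemLp u₀ 2 (arcLength S.Γ₁))
    (hu : MemLp u.trace 2 (arcLength S.Γ)) (hφ : Continuous φ) :
    HasDerivAt (fun ε : ℝ => objective S u₀ (S.perturb u ε φ))
      (innerRe (arcLength S.Γ₁) φ (u.trace - u₀)) 0 := by
  have hself := (hasDerivAt_innerRe_self ((memLp_arcLength_mono S.Γ₁_subset hu).sub hu₀)
    (memLp_arcLength_mono S.Γ₁_subset (S.memLp_Γ_of_continuous hφ))).const_mul (1 / 2 : ℝ)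
  have hpath (ε : ℝ) : (fun x => (S.perturb u ε φ).trace x - u₀ x) =
      (u.trace - u₀) + (ε : ℂ) • φ := by
    funext x
    exact add_sub_right_comm _ _ _
  simp only [objective, hpath]
  exact hself.congr_deriv (by ring)

theorem hasDerivAt_innerRe_absorbing (hu : MemLp u.trace 2 (arcLength S.Γ))
    (hun : MemLp u.normalDeriv 2 (arcLength S.Γ)) (h₁ : MemLp v₁ 2 (arcLength (S.Γ₁ ∪ S.Γ₅)))
    (hφ : ContDiff ℝ ∞ φ) :
    HasDerivAt (fun ε : ℝ => innerRe (arcLength (S.Γ₁ ∪ S.Γ₅)) (fun x =>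
        (S.perturb u ε φ).normalDeriv x + k * alpha K * (S.perturb u ε φ).trace x) v₁)
      (innerRe (arcLength (S.Γ₁ ∪ S.Γ₅)) (S.dn φ + (k * alpha K) • φ) v₁) 0 := by
  have hpath (ε : ℝ) : (fun x => (S.perturb u ε φ).normalDeriv x
      + k * alpha K * (S.perturb u ε φ).trace x) =
      (u.normalDeriv + (k * alpha K) • u.trace) + (ε : ℂ) • (S.dn φ + (k * alpha K) • φ) := by
    funext x
    simp only [Configuration.perturb, Pi.add_apply, Pi.smul_apply, smul_eq_mul]
    ring
  simp only [hpath]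
  exact hasDerivAt_innerRe (memLp_arcLength_mono S.Γ₁_union_Γ₅_subset (hun.add (hu.const_smul _)))
    (memLp_arcLength_mono S.Γ₁_union_Γ₅_subset
      ((S.memLp_dn hφ).add ((S.memLp_Γ_of_continuous hφ.continuous).const_smul _))) h₁

theorem hasDerivAt_innerRe_radiation (hu : MemLp u.trace 2 (arcLength S.Γ))
    (hun : MemLp u.normalDeriv 2 (arcLength S.Γ)) (h₃ : MemLp v₃ 2 (arcLength S.Γ₄))
    (hφ : ContDiff ℝ ∞ φ) :
    HasDerivAt (fun ε : ℝ => innerRe (arcLength S.Γ₄) (fun x =>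
        ((S.perturb u ε φ).normalDeriv x - S.dn (incoming k A θ) x)
          - Complex.I * k * ((S.perturb u ε φ).trace x - incoming k A θ x)) v₃)
      (innerRe (arcLength S.Γ₄) (S.dn φ + (-(Complex.I * k)) • φ) v₃) 0 := by
  have hpath (ε : ℝ) : (fun x => ((S.perturb u ε φ).normalDeriv x - S.dn (incoming k A θ) x)
      - Complex.I * k * ((S.perturb u ε φ).trace x - incoming k A θ x)) =
      ((u.normalDeriv - S.dn (incoming k A θ)) - (Complex.I * k) • (u.trace - incoming k A θ))
        + (ε : ℂ) • (S.dn φ + (-(Complex.I * k)) • φ) := by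
    funext x
    simp only [Configuration.perturb, Pi.add_apply, Pi.sub_apply, Pi.smul_apply, smul_eq_mul]
    ring
  have hinc := contDiff_incoming k A θ
  simp only [hpath]
  exact hasDerivAt_innerRe
    (memLp_arcLength_mono S.Γ₄_subset ((hun.sub (S.memLp_dn hinc)).sub
      ((hu.sub (S.memLp_Γ_of_continuous hinc.continuous)).const_smul _)))
    (memLp_arcLength_mono S.Γ₄_subset
      ((S.memLp_dn hφ).add ((S.memLp_Γ_of_continuous hφ.continuous).const_smul _))) h₃

theorem hasDerivAt_lagrangian (hu₀ : MemLp u₀ 2 (arcLength S.Γ₁)) (hu : S.MemH1 u.toTracedField)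
    (hun : MemLp u.normalDeriv 2 (arcLength S.Γ)) (hv : S.MemH1 v)
    (h₁ : MemLp v₁ 2 (arcLength (S.Γ₁ ∪ S.Γ₅))) (h₂ : MemLp v₂ 2 (arcLength (S.Γ₂ ∪ S.Γ₃)))
    (h₃ : MemLp v₃ 2 (arcLength S.Γ₄)) (hφ : ContDiff ℝ ∞ φ) :
    HasDerivAt (fun ε : ℝ => lagrangian S k A θ K u₀ (S.perturb u ε φ) v v₁ v₂ v₃)
      (lagrangianDeriv S k K u₀ u v v₁ v₂ v₃ φ) 0 := by
  obtain ⟨⟨hu_fn, hu_grad, -⟩, hu_trace, -⟩ := hu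
  obtain ⟨⟨hv_fn, hv_grad, -⟩, hv_trace, -⟩ := hv
  have hΩ := S.isLipschitzDomain_Ω
  have hφΓ : MemLp φ 2 (arcLength S.Γ) := S.memLp_Γ_of_continuous hφ.continuous
  have hgrad := HasDerivAt.fun_sum (u := Finset.univ) fun i _ => hasDerivAt_innerRe (hu_grad i)
    (hΩ.memLp_of_continuous (continuous_pderiv hφ i)) (hv_grad i)
  have hfn := (hasDerivAt_innerRe hu_fn (hΩ.memLp_of_continuous hφ.continuous)
    hv_fn).const_mul (k ^ 2)
  have hnormal := hasDerivAt_innerRe hun (S.memLp_dn hφ) hv_trace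
  have hlateral {A : Set Plane} (hA : A ⊆ S.Γ) (hA₂ : A ⊆ S.Γ₂ ∪ S.Γ₃) :=
    hasDerivAt_innerRe (memLp_arcLength_mono hA hu_trace) (memLp_arcLength_mono hA hφΓ)
      (memLp_arcLength_mono hA₂ h₂)
  exact (((((((hasDerivAt_objective hu₀ hu_trace hφ.continuous).add hgrad).sub hfn).sub
    hnormal).sub (hasDerivAt_innerRe_absorbing hu_trace hun h₁ hφ)).add
    (hlateral S.Γ₂_subset Set.subset_union_left)).add
    (hlateral S.Γ₃_subset Set.subset_union_right)).sub
    (hasDerivAt_innerRe_radiation hu_trace hun h₃ hφ)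

theorem memLp_normalCoeff (hv : MemLp v.trace 2 (arcLength S.Γ))
    (h₁ : MemLp v₁ 2 (arcLength (S.Γ₁ ∪ S.Γ₅))) (h₃ : MemLp v₃ 2 (arcLength S.Γ₄)) :
    MemLp (normalCoeff S v v₁ v₃) 2 (arcLength S.Γ) :=
  (hv.add (memLp_arcLength_indicator S.measurable₁₅ S.Γ₁_union_Γ₅_subset h₁)).add
    (memLp_arcLength_indicator S.measurable₄ S.Γ₄_subset h₃)

theorem memLp_traceCoeff (hu₀ : MemLp u₀ 2 (arcLength S.Γ₁))
    (hu : MemLp u.trace 2 (arcLength S.Γ)) (h₁ : MemLp v₁ 2 (arcLength (S.Γ₁ ∪ S.Γ₅)))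
    (h₂ : MemLp v₂ 2 (arcLength (S.Γ₂ ∪ S.Γ₃))) (h₃ : MemLp v₃ 2 (arcLength S.Γ₄)) :
    MemLp (traceCoeff S k K u₀ u v₁ v₂ v₃) 2 (arcLength S.Γ) := by
  have habsorbing := memLp_arcLength_indicator S.measurable₁₅ S.Γ₁_union_Γ₅_subset h₁
  have hradiation := memLp_arcLength_indicator S.measurable₄ S.Γ₄_subset h₃
  have htracking := memLp_arcLength_indicator S.measurable₁ S.Γ₁_subset
    ((memLp_arcLength_mono S.Γ₁_subset hu).sub hu₀)
  have hlateral₂ := memLp_arcLength_indicator S.measurable₂ S.Γ₂_subset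
    (memLp_arcLength_mono Set.subset_union_left h₂)
  have hlateral₃ := memLp_arcLength_indicator S.measurable₃ S.Γ₃_subset
    (memLp_arcLength_mono Set.subset_union_right h₂)
  exact ((((habsorbing.const_smul _).add (hradiation.const_smul _)).sub htracking).sub
    hlateral₂).sub hlateral₃

theorem innerRe_normalCoeff (hv : MemLp v.trace 2 (arcLength S.Γ))
    (h₁ : MemLp v₁ 2 (arcLength (S.Γ₁ ∪ S.Γ₅))) (h₃ : MemLp v₃ 2 (arcLength S.Γ₄))
    {f : Plane → ℂ} (hf : MemLp f 2 (arcLength S.Γ)) :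
    innerRe (arcLength S.Γ) (normalCoeff S v v₁ v₃) f = innerRe (arcLength S.Γ) v.trace f
      + innerRe (arcLength (S.Γ₁ ∪ S.Γ₅)) v₁ f + innerRe (arcLength S.Γ₄) v₃ f := by
  have habsorbing := memLp_arcLength_indicator S.measurable₁₅ S.Γ₁_union_Γ₅_subset h₁
  have hradiation := memLp_arcLength_indicator S.measurable₄ S.Γ₄_subset h₃
  rw [normalCoeff, innerRe_add_left (hv.add habsorbing) hradiation hf,
    innerRe_add_left hv habsorbing hf,
    innerRe_arcLength_indicator S.measurable₁₅ S.Γ₁_union_Γ₅_subset,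
    innerRe_arcLength_indicator S.measurable₄ S.Γ₄_subset]

theorem innerRe_traceCoeff (hu₀ : MemLp u₀ 2 (arcLength S.Γ₁))
    (hu : MemLp u.trace 2 (arcLength S.Γ)) (h₁ : MemLp v₁ 2 (arcLength (S.Γ₁ ∪ S.Γ₅)))
    (h₂ : MemLp v₂ 2 (arcLength (S.Γ₂ ∪ S.Γ₃))) (h₃ : MemLp v₃ 2 (arcLength S.Γ₄))
    {f : Plane → ℂ} (hf : MemLp f 2 (arcLength S.Γ)) :
    innerRe (arcLength S.Γ) (traceCoeff S k K u₀ u v₁ v₂ v₃) f =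
      innerRe (arcLength (S.Γ₁ ∪ S.Γ₅)) v₁ ((k * alpha K) • f)
        + innerRe (arcLength S.Γ₄) v₃ ((-(Complex.I * k)) • f)
        - innerRe (arcLength S.Γ₁) (u.trace - u₀) f
        - innerRe (arcLength S.Γ₂) v₂ f - innerRe (arcLength S.Γ₃) v₂ f := by
  have habsorbing := (memLp_arcLength_indicator S.measurable₁₅ S.Γ₁_union_Γ₅_subset h₁).const_smul
    (-(k * alpha K))
  have hradiation := (memLp_arcLength_indicator S.measurable₄ S.Γ₄_subset h₃).const_smul
    (Complex.I * k)
  have htracking := memLp_arcLength_indicator S.measurable₁ S.Γ₁_subset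
    ((memLp_arcLength_mono S.Γ₁_subset hu).sub hu₀)
  have hlateral₂ := memLp_arcLength_indicator S.measurable₂ S.Γ₂_subset
    (memLp_arcLength_mono Set.subset_union_left h₂)
  have hlateral₃ := memLp_arcLength_indicator S.measurable₃ S.Γ₃_subset
    (memLp_arcLength_mono Set.subset_union_right h₂)
  have hconjα : conj (-(k * alpha K)) = k * alpha K := by
    rw [map_neg, map_mul, conj_alpha, Complex.conj_ofReal, mul_neg, neg_neg]
  have hconjI : conj (Complex.I * k) = -(Complex.I * k) := by
    rw [map_mul, Complex.conj_I, Complex.conj_ofReal, neg_mul]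
  rw [traceCoeff,
    innerRe_sub_left (((habsorbing.add hradiation).sub htracking).sub hlateral₂) hlateral₃ hf,
    innerRe_sub_left ((habsorbing.add hradiation).sub htracking) hlateral₂ hf,
    innerRe_sub_left (habsorbing.add hradiation) htracking hf,
    innerRe_add_left habsorbing hradiation hf, innerRe_smul_left, innerRe_smul_left,
    hconjα, hconjI]
  simp only [innerRe_arcLength_indicator, S.measurable₁, S.measurable₂, S.measurable₃,
    S.measurable₄, S.measurable₁₅, S.Γ₁_subset, S.Γ₂_subset, S.Γ₃_subset, S.Γ₄_subset,
    S.Γ₁_union_Γ₅_subset]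

theorem lagrangianDeriv_eq_re_greenForm (hu₀ : MemLp u₀ 2 (arcLength S.Γ₁))
    (hu : MemLp u.trace 2 (arcLength S.Γ)) (hv : S.MemH1 v)
    (h₁ : MemLp v₁ 2 (arcLength (S.Γ₁ ∪ S.Γ₅))) (h₂ : MemLp v₂ 2 (arcLength (S.Γ₂ ∪ S.Γ₃)))
    (h₃ : MemLp v₃ 2 (arcLength S.Γ₄)) (hφ : ContDiff ℝ ∞ φ) :
    lagrangianDeriv S k K u₀ u v v₁ v₂ v₃ φ =
      (greenForm S.Ω v.grad (fun x => -((k : ℂ) ^ 2 * v.fn x)) (traceCoeff S k K u₀ u v₁ v₂ v₃)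
        (normalCoeff S v v₁ v₃) fun x => conj (φ x)).re := by
  have hφΓ : MemLp φ 2 (arcLength S.Γ) := S.memLp_Γ_of_continuous hφ.continuous
  have hdn : MemLp (S.dn φ) 2 (arcLength S.Γ) := S.memLp_dn hφ
  have hmass : innerRe (volume.restrict S.Ω) (fun x => -((k : ℂ) ^ 2 * v.fn x)) φ =
      -(k ^ 2 * innerRe (volume.restrict S.Ω) v.fn φ) := by
    rw [← neg_mul, ← innerRe_ofReal_smul_left]
    congr 1 with x
    simp
  rw [S.isLipschitzDomain_Ω.re_greenForm_conj hv.1.2.1 hφ, ← S.Γ_eq_frontier_Ω]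
  change _ = _ - innerRe (arcLength S.Γ) _ (S.dn φ)
  rw [innerRe_normalCoeff hv.2.1 h₁ h₃ hdn, innerRe_traceCoeff hu₀ hu h₁ h₂ h₃ hφΓ, hmass,
    lagrangianDeriv, innerRe_add_left (memLp_arcLength_mono S.Γ₁_union_Γ₅_subset hdn)
      ((memLp_arcLength_mono S.Γ₁_union_Γ₅_subset hφΓ).const_smul _) h₁,
    innerRe_add_left (memLp_arcLength_mono S.Γ₄_subset hdn)
      ((memLp_arcLength_mono S.Γ₄_subset hφΓ).const_smul _) h₃]
  simp only [innerRe_comm _ φ, innerRe_comm _ (S.dn φ), innerRe_comm _ (pderiv _ φ),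
    innerRe_comm _ (_ • φ)]
  ring

theorem isAdjoint_iff_isNormalDeriv (hu₀ : MemLp u₀ 2 (arcLength S.Γ₁))
    (hu : S.MemH1 u.toTracedField) (hun : MemLp u.normalDeriv 2 (arcLength S.Γ))
    (hv : S.MemH1 v) :
    IsAdjoint S k A θ K u₀ u v ↔ ∃ v₁ v₂ v₃ : Plane → ℂ, MemLp v₁ 2 (arcLength (S.Γ₁ ∪ S.Γ₅)) ∧
      MemLp v₂ 2 (arcLength (S.Γ₂ ∪ S.Γ₃)) ∧ MemLp v₃ 2 (arcLength S.Γ₄) ∧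
      (∀ᵐ x ∂arcLength S.Γ, normalCoeff S v v₁ v₃ x = 0) ∧
      IsNormalDeriv S.Ω S.Γ v.grad (fun x => -((k : ℂ) ^ 2 * v.fn x))
        (traceCoeff S k K u₀ u v₁ v₂ v₃) := by
  refine exists₃_congr fun v₁ v₂ v₃ => and_congr_right fun h₁ => and_congr_right fun h₂ =>
    and_congr_right fun h₃ => ?_
  have hgreen := S.isLipschitzDomain_Ω.forall_greenForm_eq_zero_iff hv.1.2.1
    (F := fun x => -((k : ℂ) ^ 2 * v.fn x)) (hv.1.1.const_mul _).neg
    (S.Γ_eq_frontier_Ω ▸ memLp_traceCoeff (k := k) (K := K) hu₀ hu.2.1 h₁ h₂ h₃)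
    (S.Γ_eq_frontier_Ω ▸ memLp_normalCoeff hv.2.1 h₁ h₃)
  rw [S.Γ_eq_frontier_Ω, ← hgreen, ← forall_re_greenForm_eq_zero_iff]
  have hderiv {φ : Plane → ℂ} (hφ : IsTest φ) :
      HasDerivAt (fun ε : ℝ => lagrangian S k A θ K u₀ (S.perturb u ε φ) v v₁ v₂ v₃)
        (greenForm S.Ω v.grad (fun x => -((k : ℂ) ^ 2 * v.fn x))
          (traceCoeff S k K u₀ u v₁ v₂ v₃) (normalCoeff S v v₁ v₃) fun x => conj (φ x)).re 0 :=
    lagrangianDeriv_eq_re_greenForm hu₀ hu.2.1 hv h₁ h₂ h₃ hφ.1 ▸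
      hasDerivAt_lagrangian hu₀ hu hun hv h₁ h₂ h₃ hφ.1
  refine ⟨fun h φ hφ => ?_, fun h φ hφ => h _ (isTest_conj hφ) ▸ hderiv hφ⟩
  simpa only [Complex.conj_conj] using (hderiv (isTest_conj hφ)).unique (h _ (isTest_conj hφ))

end Lagrangian

/-! ### The boundary conditions of the adjoint problem -/

theorem ae_arcLength_notMem {A B : Set Plane} (hA : MeasurableSet A)
    (h : AEDisjoint (Measure.hausdorffMeasure 1) A B) : ∀ᵐ x ∂arcLength A, x ∉ B := by
  rw [arcLength, ae_restrict_iff' hA]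
  exact measure_mono_null (fun x hx => by simpa using hx) h

namespace Configuration

variable (S : Configuration)

theorem notMem_Γ₅ {x : Plane} (hx : x ∈ S.Γ₁ ∪ S.Γ₂ ∪ S.Γ₃ ∪ S.Γ₄) : x ∉ S.Γ₅ := fun h =>
  S.frontier_tank_subset (S.union_eq ▸ hx) (frontier_subset_closure h)

theorem ae_arcLength_Γ_iff {P : Plane → Prop} : (∀ᵐ x ∂arcLength S.Γ, P x) ↔
    (∀ᵐ x ∂arcLength S.Γ₁, P x) ∧ (∀ᵐ x ∂arcLength S.Γ₅, P x) ∧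
    (∀ᵐ x ∂arcLength S.Γ₄, P x) ∧ (∀ᵐ x ∂arcLength (S.Γ₂ ∪ S.Γ₃), P x) := by
  simp only [arcLength, Γ, ae_restrict_union_iff]
  tauto

end Configuration

section BoundaryConditions

variable {S : Configuration} {k K : ℝ} {u₀ : Plane → ℂ} {u : CauchyField} {v : TracedField}
  {v₁ v₂ v₃ d : Plane → ℂ}

theorem ae_coeff_Γ₁ : ∀ᵐ x ∂arcLength S.Γ₁, normalCoeff S v v₁ v₃ x = v.trace x + v₁ x ∧
    traceCoeff S k K u₀ u v₁ v₂ v₃ x = -(k * alpha K * v₁ x) - (u.trace x - u₀ x) := by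
  filter_upwards [ae_restrict_mem S.measurable₁, ae_arcLength_notMem S.measurable₁ S.disjoint₁₂,
    ae_arcLength_notMem S.measurable₁ S.disjoint₁₃,
    ae_arcLength_notMem S.measurable₁ S.disjoint₁₄] with x h₁ h₂ h₃ h₄
  simp [normalCoeff, traceCoeff, h₁, h₂, h₃, h₄]

theorem ae_coeff_Γ₅ : ∀ᵐ x ∂arcLength S.Γ₅, normalCoeff S v v₁ v₃ x = v.trace x + v₁ x ∧
    traceCoeff S k K u₀ u v₁ v₂ v₃ x = -(k * alpha K * v₁ x) := by
  filter_upwards [ae_restrict_mem S.measurable₅] with x h₅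
  have h : x ∉ S.Γ₁ ∪ S.Γ₂ ∪ S.Γ₃ ∪ S.Γ₄ := fun hx => S.notMem_Γ₅ hx h₅
  simp only [Set.mem_union, not_or] at h
  obtain ⟨⟨⟨h₁, h₂⟩, h₃⟩, h₄⟩ := h
  simp [normalCoeff, traceCoeff, h₁, h₂, h₃, h₄, h₅]

theorem ae_coeff_Γ₄ : ∀ᵐ x ∂arcLength S.Γ₄, normalCoeff S v v₁ v₃ x = v.trace x + v₃ x ∧
    traceCoeff S k K u₀ u v₁ v₂ v₃ x = Complex.I * k * v₃ x := by
  filter_upwards [ae_restrict_mem S.measurable₄,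
    ae_arcLength_notMem S.measurable₄ S.disjoint₁₄.symm,
    ae_arcLength_notMem S.measurable₄ S.disjoint₂₄.symm,
    ae_arcLength_notMem S.measurable₄ S.disjoint₃₄.symm] with x h₄ h₁ h₂ h₃
  have h₅ : x ∉ S.Γ₅ := S.notMem_Γ₅ (.inr h₄)
  simp [normalCoeff, traceCoeff, h₁, h₂, h₃, h₄, h₅]

theorem ae_coeff_Γ₂_union_Γ₃ : ∀ᵐ x ∂arcLength (S.Γ₂ ∪ S.Γ₃),
    normalCoeff S v v₁ v₃ x = v.trace x ∧ traceCoeff S k K u₀ u v₁ v₂ v₃ x = -v₂ x := by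
  refine (ae_restrict_union_iff _ _ _).2 ⟨?_, ?_⟩
  · filter_upwards [ae_restrict_mem S.measurable₂,
      ae_arcLength_notMem S.measurable₂ S.disjoint₁₂.symm,
      ae_arcLength_notMem S.measurable₂ S.disjoint₂₃,
      ae_arcLength_notMem S.measurable₂ S.disjoint₂₄] with x h₂ h₁ h₃ h₄
    have h₅ : x ∉ S.Γ₅ := S.notMem_Γ₅ (.inl (.inl (.inr h₂)))
    simp [normalCoeff, traceCoeff, h₁, h₂, h₃, h₄, h₅]
  · filter_upwards [ae_restrict_mem S.measurable₃,
      ae_arcLength_notMem S.measurable₃ S.disjoint₁₃.symm,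
      ae_arcLength_notMem S.measurable₃ S.disjoint₂₃.symm,
      ae_arcLength_notMem S.measurable₃ S.disjoint₃₄] with x h₃ h₁ h₂ h₄
    have h₅ : x ∉ S.Γ₅ := S.notMem_Γ₅ (.inl (.inr h₃))
    simp [normalCoeff, traceCoeff, h₁, h₂, h₃, h₄, h₅]

theorem ae_coeff_iff :
    (∀ᵐ x ∂arcLength S.Γ,
      normalCoeff S v v₁ v₃ x = 0 ∧ traceCoeff S k K u₀ u v₁ v₂ v₃ x = d x) ↔
    (∀ᵐ x ∂arcLength S.Γ₁,
      v₁ x = -v.trace x ∧ d x = -(u.trace x - u₀ x) + k * alpha K * v.trace x) ∧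
    (∀ᵐ x ∂arcLength S.Γ₅, v₁ x = -v.trace x ∧ d x = k * alpha K * v.trace x) ∧
    (∀ᵐ x ∂arcLength S.Γ₄, v₃ x = -v.trace x ∧ d x = -(Complex.I * k * v.trace x)) ∧
    (∀ᵐ x ∂arcLength (S.Γ₂ ∪ S.Γ₃), v.trace x = 0 ∧ v₂ x = -d x) := by
  rw [S.ae_arcLength_Γ_iff]
  refine and_congr (eventually_congr ?_) (and_congr (eventually_congr ?_)
    (and_congr (eventually_congr ?_) (eventually_congr ?_)))
  · filter_upwards [ae_coeff_Γ₁] with x hx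
    rw [hx.1, hx.2, add_comm, add_eq_zero_iff_eq_neg]
    grind
  · filter_upwards [ae_coeff_Γ₅] with x hx
    rw [hx.1, hx.2, add_comm, add_eq_zero_iff_eq_neg]
    grind
  · filter_upwards [ae_coeff_Γ₄] with x hx
    rw [hx.1, hx.2, add_comm, add_eq_zero_iff_eq_neg]
    grind
  · filter_upwards [ae_coeff_Γ₂_union_Γ₃] with x hx
    rw [hx.1, hx.2, neg_eq_iff_eq_neg]

end BoundaryConditions

theorem IsNormalDeriv.congr_ae {U Γ : Set Plane} {G : Fin 2 → Plane → ℂ} {F d d' : Plane → ℂ}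
    (h : IsNormalDeriv U Γ G F d) (hd : d =ᵐ[arcLength Γ] d') : IsNormalDeriv U Γ G F d' :=
  ⟨(memLp_congr_ae hd).1 h.1, fun φ hφ => (h.2 φ hφ).trans
    (integral_congr_ae (hd.mono fun x hx => congrArg (· * φ x) hx))⟩

/-- `u` is an `H¹(Ω)` function with its weak gradient, its trace and its normal derivative on `Γ`,
the latter being in `L²(Γ)`. -/
def Configuration.HasCauchyData (S : Configuration) (u : CauchyField) : Prop :=
  S.MemH1 u.toTracedField ∧
    ∃ ℓ, IsWeakLaplacian S.Ω u.grad ℓ ∧ IsNormalDeriv S.Ω S.Γ u.grad ℓ u.normalDeriv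

theorem IsStateSolution.hasCauchyData {S : Configuration} {k A θ K : ℝ} {u : CauchyField}
    (hu : IsStateSolution S k A θ K u) : S.HasCauchyData u :=
  ⟨hu.memH1, _, hu.helmholtz, hu.normalDeriv⟩

end Helmholtz

end

open Helmholtz in
theorem mainTheorem1_general (S : Configuration) (k A θ K : ℝ) (_hK : K ≠ -1) (u₀ : Plane → ℂ)
    (hu₀ : MemLp u₀ 2 (arcLength S.Γ₁)) (u : CauchyField) (hu : S.HasCauchyData u)
    (v : TracedField) (hv : S.MemH1 v) :
    IsAdjoint S k A θ K u₀ u v ↔ SolvesAdjointProblem S k K u₀ u v := by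
  obtain ⟨hu, ℓ, -, hun⟩ := hu
  rw [isAdjoint_iff_isNormalDeriv hu₀ hu hun.1 hv]
  constructor
  · rintro ⟨v₁, v₂, v₃, -, -, -, hnormal, hd⟩
    obtain ⟨h₁, h₅, h₄, h₂₃⟩ := ae_coeff_iff.1 (hnormal.mono fun _ hx => ⟨hx, rfl⟩)
    exact ⟨(S.Γ_eq_frontier_Ω ▸ hd).isWeakLaplacian S.isLipschitzDomain_Ω.isOpen
        (hv.1.1.const_mul _).neg, _, hd, h₁.mono fun _ h => h.2, h₅.mono fun _ h => h.2,
      h₄.mono fun _ h => h.2, h₂₃.mono fun _ h => h.1⟩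
  · rintro ⟨-, d, hd, h₁, h₅, h₄, h₂₃⟩
    have hcoeff := (ae_coeff_iff (v₁ := -v.trace) (v₂ := -d) (v₃ := -v.trace)).2
      ⟨h₁.mono fun _ h => ⟨rfl, h⟩, h₅.mono fun _ h => ⟨rfl, h⟩, h₄.mono fun _ h => ⟨rfl, h⟩,
        h₂₃.mono fun _ h => ⟨h, rfl⟩⟩
    have htrace : MemLp (-v.trace) 2 (arcLength S.Γ) := hv.2.1.neg
    exact ⟨-v.trace, -d, -v.trace, memLp_arcLength_mono S.Γ₁_union_Γ₅_subset htrace,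
      memLp_arcLength_mono (Set.union_subset S.Γ₂_subset S.Γ₃_subset) hd.1.neg,
      memLp_arcLength_mono S.Γ₄_subset htrace, hcoeff.mono fun _ h => h.1,
      hd.congr_ae (hcoeff.mono fun _ h => h.2.symm)⟩

theorem mainTheorem1 (S : Helmholtz.Configuration) (k A θ K : ℝ) (hk : 0 < k) (hA : 0 < A)
    (hK : K ≠ -1) (u₀ : Helmholtz.Plane → ℂ)
    (hu₀ : MeasureTheory.MemLp u₀ 2 (Helmholtz.arcLength S.Γ₁))
    (u : Helmholtz.CauchyField) (hu : Helmholtz.IsStateSolution S k A θ K u)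
    (v : Helmholtz.TracedField) (hv : S.MemH1 v) :
    Helmholtz.IsAdjoint S k A θ K u₀ u v ↔ Helmholtz.SolvesAdjointProblem S k K u₀ u v :=
  mainTheorem1_general S k A θ K hK u₀ hu₀ u hu.hasCauchyData v hv
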